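/- Let $(E,\mathcal E)$ be a measurable space and let $Q$ be a bounded positive kernel on it: $Q(x,\cdot)$ is a positive measure for each $x\in E$, $Q(\cdot,A)$ is measurable for each $A\in\mathcal E$, and $\sup_{x}Q(x,E)<\infty$. Let $w:E\to[1,+\infty)$ be measurable, and let $\mathcal B_w$ be the Banach space of measurable functions $f:E\to\mathbb C$ with $\|f\|_w=\sup_E w^{-1}|f|<\infty$. Assume that $w^{-1}(Qw)$ is bounded, so that $Qf(x)=\int f(y)\,Q(x,dy)$ and, for every bounded measurable $\chi:E\times E\to\mathbb C$, $Q_\chi f(x)=\int f(y)\chi(x,y)\,Q(x,dy)$ define bounded operators on $\mathcal B_w$. Put $\|\chi\|=\sup_{E\times E}|\chi|$. For a bounded operator $T$ on $\mathcal B_w$, let $r^w(T)$ be its spectral radius, and let $r^w_e(T)$ be the infimum of $r^w(T)$ and of the real numbers $\rho\ge 0$ for which $\mathcal B_w=F\oplus H$ with $T$-invariant subspaces $F,H$ such that $H$ is closed, $r(T|_H)<\rho$, $\dim F<\infty$, and all eigenvalues of $T|_F$ have modulus $\ge\rho$. The operator $T$ is called quasi-compact on $\mathcal B_w$ if $r^w_e(T)<r^w(T)$.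 For a probability measure $\nu$ on $(E,\mathcal E)$, let $\mathcal H^{(w)}_\nu$ be the set of measurable functions $\alpha:E\times E\to[0,\infty)$ such that, with $\alpha^{(w)}(x,y)=w(x)^{-1}\alpha(x,y)w(y)$, $$\lim_{m\to+\infty}\ \sup_{x\in E}\int_{\{y:\,\alpha^{(w)}(x,y)\ge m\}}\alpha^{(w)}(x,y)\,d\nu(y)=0,$$ and put $T_{\nu,\alpha}(x,A)=\int_A\alpha(x,y)\,d\nu(y)$. **Theorem.** Assume that there are an integer $\ell\ge1$, a probability measure $\nu$ on $(E,\mathcal E)$ and $\alpha\in\mathcal H^{(w)}_\nu$ such that $S=Q^\ell-T_{\nu,\alpha}\ge0$ (that is, $Q^\ell(x,A)\ge T_{\nu,\alpha}(x,A)$ for all $x\in E$, $A\in\mathcal E$) and $r^w(S)^{1/\ell}<r^w(Q)$. Then: (i) $Q$ is quasi-compact on $\mathcal B_w$ and $r^w_e(Q)\le r^w(S)^{1/\ell}$; (ii) if moreover $\ell=1$ or $\mathcal E$ is countably generated, then for every bounded measurable $\chi:E\times E\to\mathbb C$ with $\|\chi\|\,r^w(S)^{1/\ell}<r^w(Q_\chi)$,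 the operator $Q_\chi$ is quasi-compact on $\mathcal B_w$ and $r^w_e(Q_\chi)\le\|\chi\|\,r^w(S)^{1/\ell}$. -/

import Mathlib

open MeasureTheory ProbabilityTheory Filter Topology
open scoped NNReal ENNReal

namespace WeightedKernel

/-! ### Essential spectral radius and quasi-compactness -/

section EssentialSpectralRadius

variable {B : Type*} [NormedAddCommGroup B] [NormedSpace ℂ B]

/-- `B = F ⊕ H` with `F`, `H` invariant under `T`, `H` closed, `r(T|_H) < ρ`, `dim F < ∞`, and
every eigenvalue of `T|_F` has modulus at least `ρ`. -/
def SplitsAt (T : B →L[ℂ] B) (ρ : ℝ≥0) : Prop :=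
  ∃ (F H : Submodule ℂ B) (hF : ∀ f ∈ F, T f ∈ F) (hH : ∀ f ∈ H, T f ∈ H),
    IsCompl F H ∧
    IsClosed (H : Set B) ∧
    spectralRadius ℂ (T.restrict hH) < (ρ : ℝ≥0∞) ∧
    FiniteDimensional ℂ F ∧
    ∀ z : ℂ, Module.End.HasEigenvalue ((T : B →ₗ[ℂ] B).restrict hF) z → ρ ≤ ‖z‖₊

/-- The essential spectral radius: the infimum of `r(T)` and of all real `ρ ≥ 0` at which `T`
splits in the sense of `SplitsAt`. -/
noncomputable def essSpectralRadius (T : B →L[ℂ] B) : ℝ≥0∞ :=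
  spectralRadius ℂ T ⊓ ⨅ (ρ : ℝ≥0) (_ : SplitsAt T ρ), (ρ : ℝ≥0∞)

/-- `T` is quasi-compact if its essential spectral radius is smaller than its spectral radius. -/
def QuasiCompact (T : B →L[ℂ] B) : Prop :=
  essSpectralRadius T < spectralRadius ℂ T

end EssentialSpectralRadius

/-! ### The weighted space -/

/-- A measurable function from `E` to `[1, ∞)`. -/
structure Weight (E : Type*) [MeasurableSpace E] where
  toFun : E → ℝ≥0
  measurable' : Measurable toFun
  one_le' : ∀ x, 1 ≤ toFun x

variable {E : Type*} [MeasurableSpace E]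

instance : CoeFun (Weight E) (fun _ => E → ℝ≥0) := ⟨Weight.toFun⟩

theorem Weight.pos (w : Weight E) (x : E) : (0 : ℝ) < w x :=
  lt_of_lt_of_le one_pos (by exact_mod_cast w.one_le' x)

/-- The measurable functions `f : E → ℂ` with `sup |f| / w < ∞`, as a linear subspace. -/
def boundedSubmodule (w : Weight E) : Submodule ℂ (E → ℂ) where
  carrier := {f | Measurable f ∧ ∃ C : ℝ, ∀ x, ‖f x‖ / w x ≤ C}
  zero_mem' := ⟨measurable_const, 0, fun x => by simp⟩
  add_mem' := by
    rintro f g ⟨hf, C, hC⟩ ⟨hg, D, hD⟩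
    refine ⟨hf.add hg, C + D, fun x => ?_⟩
    calc ‖(f + g) x‖ / w x ≤ (‖f x‖ + ‖g x‖) / w x := by
          gcongr; exact norm_add_le _ _
      _ = ‖f x‖ / w x + ‖g x‖ / w x := add_div _ _ _
      _ ≤ C + D := add_le_add (hC x) (hD x)
  smul_mem' := by
    rintro c f ⟨hf, C, hC⟩
    refine ⟨hf.const_smul c, ‖c‖ * C, fun x => ?_⟩
    rw [Pi.smul_apply, norm_smul, mul_div_assoc]
    exact mul_le_mul_of_nonneg_left (hC x) (norm_nonneg _)

/-- The space `𝓑_w` of measurable functions `f : E → ℂ` with `sup |f| / w < ∞`. It is not given the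
product topology of `E → ℂ`, but the topology of the norm `‖f‖_w = sup |f| / w`. -/
def Bw (w : Weight E) : Type _ := boundedSubmodule w

namespace Bw

variable {w : Weight E}

instance : AddCommGroup (Bw w) := inferInstanceAs (AddCommGroup (boundedSubmodule w))
instance : Module ℂ (Bw w) := inferInstanceAs (Module ℂ (boundedSubmodule w))
instance : CoeFun (Bw w) (fun _ => E → ℂ) := ⟨fun f => f.1⟩

theorem ext {f g : Bw w} (h : ∀ x, f x = g x) : f = g := Subtype.ext (funext h)
@[simp] theorem zero_apply (x : E) : (0 : Bw w) x = 0 := rfl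
@[simp] theorem add_apply (f g : Bw w) (x : E) : (f + g) x = f x + g x := rfl
@[simp] theorem smul_apply (c : ℂ) (f : Bw w) (x : E) : (c • f) x = c * f x := rfl

theorem measurable (f : Bw w) : Measurable f := f.2.1

noncomputable instance : Norm (Bw w) := ⟨fun f => ⨆ x, ‖f x‖ / w x⟩

theorem norm_def (f : Bw w) : ‖f‖ = ⨆ x, ‖f x‖ / w x := rfl

theorem bddAbove (f : Bw w) : BddAbove (Set.range fun x => ‖f x‖ / w x) := by
  obtain ⟨C, hC⟩ := f.2.2
  exact ⟨C, by rintro _ ⟨x, rfl⟩; exact hC x⟩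

theorem norm_nonneg' (f : Bw w) : 0 ≤ ‖f‖ :=
  Real.iSup_nonneg fun x => div_nonneg (norm_nonneg _) (w.pos x).le

theorem apply_le (f : Bw w) (x : E) : ‖f x‖ ≤ ‖f‖ * w x :=
  (div_le_iff₀ (w.pos x)).1 (le_ciSup f.bddAbove x)

theorem norm_le {f : Bw w} {C : ℝ} (hC : 0 ≤ C) (h : ∀ x, ‖f x‖ ≤ C * w x) : ‖f‖ ≤ C :=
  Real.iSup_le (fun x => (div_le_iff₀ (w.pos x)).2 (h x)) hC

theorem normedSpaceCore : NormedSpace.Core ℂ (Bw w) where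
  norm_nonneg := norm_nonneg'
  norm_smul c f := by
    simp only [norm_def, smul_apply, norm_mul, mul_div_assoc]
    exact (Real.mul_iSup_of_nonneg (norm_nonneg c) _).symm
  norm_triangle f g := by
    refine norm_le (add_nonneg (norm_nonneg' f) (norm_nonneg' g)) fun x => ?_
    rw [add_mul]
    exact (norm_add_le _ _).trans (add_le_add (f.apply_le x) (g.apply_le x))
  norm_eq_zero_iff f := by
    refine ⟨fun h => ext fun x => ?_, fun h => ?_⟩
    · simpa [h] using f.apply_le x
    · simp [h, norm_def]

noncomputable instance : NormedAddCommGroup (Bw w) := NormedAddCommGroup.ofCore normedSpaceCore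
noncomputable instance : NormedSpace ℂ (Bw w) := NormedSpace.ofCore normedSpaceCore

end Bw

/-! ### Action of kernels on the weighted space

A bounded positive kernel on `E` is a `κ : Kernel E E` with `IsFiniteKernel κ`; the monoid structure
of `Kernel E E` is the composition of kernels. -/

/-- The function `w⁻¹ (κ w)` is bounded. -/
def ActsOn (w : Weight E) (κ : Kernel E E) : Prop :=
  ∃ C : ℝ≥0, ∀ x, ∫⁻ y, (w y : ℝ≥0∞) ∂κ x ≤ C * w x

section Action

variable {w : Weight E} {κ : Kernel E E}

theorem integral_bound {C : ℝ≥0} {x : E}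
    (hC : ∫⁻ y, (w y : ℝ≥0∞) ∂κ x ≤ C * w x) {g : E → ℂ} (hg : Measurable g) {K : ℝ}
    (hK : 0 ≤ K) (hgK : ∀ y, ‖g y‖ ≤ K * w y) :
    Integrable g (κ x) ∧ ‖∫ y, g y ∂κ x‖ ≤ K * C * w x := by
  have hw : ∫⁻ y, ‖g y‖ₑ ∂κ x ≤ ENNReal.ofReal (K * C * w x) := by
    calc ∫⁻ y, ‖g y‖ₑ ∂κ x ≤ ∫⁻ y, ENNReal.ofReal K * (w y : ℝ≥0∞) ∂κ x := by
          refine lintegral_mono fun y => ?_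
          rw [← ofReal_norm, ← ENNReal.ofReal_coe_nnreal, ← ENNReal.ofReal_mul hK]
          exact ENNReal.ofReal_le_ofReal (hgK y)
      _ = ENNReal.ofReal K * ∫⁻ y, (w y : ℝ≥0∞) ∂κ x :=
          lintegral_const_mul _ w.measurable'.coe_nnreal_ennreal
      _ ≤ ENNReal.ofReal K * (C * w x) := by gcongr
      _ = ENNReal.ofReal (K * C * w x) := by
          rw [mul_assoc, ENNReal.ofReal_mul hK, ← NNReal.coe_mul, ENNReal.ofReal_coe_nnreal,
            ENNReal.coe_mul]
  refine ⟨⟨hg.aestronglyMeasurable, lt_of_le_of_lt hw ENNReal.ofReal_lt_top⟩, ?_⟩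
  have h0 : (0 : ℝ) ≤ K * C * w x := by positivity
  rw [← ENNReal.ofReal_le_ofReal_iff h0, ofReal_norm]
  exact (enorm_integral_le_lintegral_enorm _).trans hw

/-- The bounded operator `f ↦ (x ↦ ∫ f(y) κ(x, dy))` on `𝓑_w`. -/
noncomputable def kernelOp (h : ActsOn w κ) : Bw w →L[ℂ] Bw w :=
  LinearMap.mkContinuousOfExistsBound
    { toFun := fun f => ⟨fun x => ∫ y, f y ∂κ x,
        (f.measurable.stronglyMeasurable.integral_kernel).measurable, by
          obtain ⟨C, hC⟩ := h
          exact ⟨‖f‖ * C, fun x => (div_le_iff₀ (w.pos x)).2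
            (integral_bound (hC x) f.measurable (norm_nonneg f) f.apply_le).2⟩⟩
      map_add' := fun f g => Bw.ext fun x => by
        obtain ⟨C, hC⟩ := h
        exact integral_add (integral_bound (hC x) f.measurable (norm_nonneg f) f.apply_le).1
          (integral_bound (hC x) g.measurable (norm_nonneg g) g.apply_le).1
      map_smul' := fun c f => Bw.ext fun x => integral_const_mul c _ }
    (by
      obtain ⟨C, hC⟩ := h
      refine ⟨C, fun f => Bw.norm_le (by positivity) fun x => ?_⟩
      rw [mul_comm (C : ℝ)]
      exact (integral_bound (hC x) f.measurable (norm_nonneg f) f.apply_le).2)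

@[simp] theorem kernelOp_apply (h : ActsOn w κ) (f : Bw w) (x : E) :
    kernelOp h f x = ∫ y, f y ∂κ x := rfl

end Action

/-- The space `𝒳` of bounded measurable functions `χ : E × E → ℂ`. -/
structure Multiplier (E : Type*) [MeasurableSpace E] where
  toFun : E × E → ℂ
  measurable' : Measurable toFun
  bounded' : ∃ C : ℝ, ∀ p, ‖toFun p‖ ≤ C

instance : CoeFun (Multiplier E) (fun _ => E × E → ℂ) := ⟨Multiplier.toFun⟩

/-- The supremum norm of `χ`, as an extended nonnegative real (it is finite). -/
noncomputable def Multiplier.supNorm (χ : Multiplier E) : ℝ≥0∞ := ⨆ p, ‖χ p‖ₑ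

section TwistedAction

variable {w : Weight E} {κ : Kernel E E}

theorem twisted_bound {χ : Multiplier E} {M : ℝ} (hM : ∀ p, ‖χ p‖ ≤ M) (f : Bw w) (x : E) :
    Measurable (fun y => f y * χ (x, y)) ∧ 0 ≤ M * ‖f‖ ∧
      ∀ y, ‖f y * χ (x, y)‖ ≤ M * ‖f‖ * w y := by
  have hM0 : 0 ≤ M := (norm_nonneg _).trans (hM (x, x))
  refine ⟨f.measurable.mul (χ.measurable'.comp measurable_prodMk_left), by positivity,
    fun y => ?_⟩
  rw [norm_mul, mul_comm, mul_assoc]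
  exact mul_le_mul (hM _) (f.apply_le y) (norm_nonneg _) hM0

variable [IsFiniteKernel κ]

/-- The bounded operator `f ↦ (x ↦ ∫ f(y) χ(x, y) κ(x, dy))` on `𝓑_w`. -/
noncomputable def twistedOp (h : ActsOn w κ) (χ : Multiplier E) : Bw w →L[ℂ] Bw w :=
  LinearMap.mkContinuousOfExistsBound
    { toFun := fun f => ⟨fun x => ∫ y, f y * χ (x, y) ∂κ x,
        (StronglyMeasurable.integral_kernel_prod_right (f := fun x y => f y * χ (x, y))
          (((f.measurable.comp measurable_snd).mul
            χ.measurable').stronglyMeasurable)).measurable, by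
          obtain ⟨C, hC⟩ := h
          obtain ⟨M, hM⟩ := χ.bounded'
          exact ⟨M * ‖f‖ * C, fun x =>
            let b := twisted_bound hM f x
            (div_le_iff₀ (w.pos x)).2 (integral_bound (hC x) b.1 b.2.1 b.2.2).2⟩⟩
      map_add' := fun f g => Bw.ext fun x => by
        obtain ⟨C, hC⟩ := h
        obtain ⟨M, hM⟩ := χ.bounded'
        have bf := twisted_bound hM f x
        have bg := twisted_bound hM g x
        change ∫ y, (f y + g y) * χ (x, y) ∂κ x = _
        simp only [add_mul]
        exact integral_add (integral_bound (hC x) bf.1 bf.2.1 bf.2.2).1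
          (integral_bound (hC x) bg.1 bg.2.1 bg.2.2).1
      map_smul' := fun c f => Bw.ext fun x => by
        change ∫ y, (c * f y) * χ (x, y) ∂κ x = _
        simp only [mul_assoc]
        exact integral_const_mul c _ }
    (by
      obtain ⟨C, hC⟩ := h
      obtain ⟨M, hM⟩ := χ.bounded'
      refine ⟨|M| * C, fun f => Bw.norm_le (by positivity) fun x => ?_⟩
      have b := twisted_bound hM f x
      refine (integral_bound (hC x) b.1 b.2.1 b.2.2).2.trans ?_
      rw [mul_right_comm |M|]
      gcongr
      exact le_abs_self M)

@[simp] theorem twistedOp_apply (h : ActsOn w κ) (χ : Multiplier E) (f : Bw w) (x : E) :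
    twistedOp h χ f x = ∫ y, f y * χ (x, y) ∂κ x := rfl

end TwistedAction

/-! ### Absolutely continuous kernels -/

/-- The kernel `T_{ν,α}(x, A) = ∫_A α(x, y) dν(y)`. -/
noncomputable def absContKernel (ν : Measure E) [IsProbabilityMeasure ν] (α : E → E → ℝ≥0) :
    Kernel E E :=
  (Kernel.const E ν).withDensity fun x y => (α x y : ℝ≥0∞)

theorem absContKernel_apply (ν : Measure E) [IsProbabilityMeasure ν] {α : E → E → ℝ≥0}
    (hα : Measurable (Function.uncurry α)) (x : E) {A : Set E} (hA : MeasurableSet A) :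
    absContKernel ν α x A = ∫⁻ y in A, (α x y : ℝ≥0∞) ∂ν := by
  rw [absContKernel, Kernel.withDensity_apply _ hα.coe_nnreal_ennreal, withDensity_apply _ hA,
    Kernel.const_apply]

/-- The class `𝓗_ν^{(w)}`: `α` is jointly measurable and the functions
`α^{(w)}(x, ·) = w(x)⁻¹ α(x, ·) w(·)`, `x ∈ E`, are uniformly `ν`-integrable. -/
structure MemHw (w : Weight E) (ν : Measure E) (α : E → E → ℝ≥0) : Prop where
  measurable : Measurable (Function.uncurry α)
  uniform : Tendsto
    (fun m : ℝ≥0 => ⨆ x, ∫⁻ y in {y | m ≤ (w x)⁻¹ * α x y * w y},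
      (((w x)⁻¹ * α x y * w y : ℝ≥0) : ℝ≥0∞) ∂ν)
    atTop (𝓝 0)

/-! ### Powers and differences of kernels -/

theorem ActsOn.pow {w : Weight E} {Q : Kernel E E} (h : ActsOn w Q) (n : ℕ) :
    ActsOn w (Q ^ n) := by
  obtain ⟨C, hC⟩ := h
  have hw : Measurable fun y => (w y : ℝ≥0∞) := w.measurable'.coe_nnreal_ennreal
  refine ⟨C ^ n, ?_⟩
  induction n with
  | zero =>
    intro x
    rw [pow_zero]
    change ∫⁻ y, (w y : ℝ≥0∞) ∂(Kernel.id : Kernel E E) x ≤ _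
    simp [Kernel.id_apply, lintegral_dirac' _ hw]
  | succ n ih =>
    intro x
    rw [pow_succ]
    change ∫⁻ y, (w y : ℝ≥0∞) ∂((Q ^ n) ∘ₖ Q) x ≤ _
    rw [Kernel.lintegral_comp _ _ _ hw]
    calc ∫⁻ z, ∫⁻ y, (w y : ℝ≥0∞) ∂(Q ^ n) z ∂Q x
        ≤ ∫⁻ z, ((C ^ n : ℝ≥0) : ℝ≥0∞) * w z ∂Q x := lintegral_mono ih
      _ = ((C ^ n : ℝ≥0) : ℝ≥0∞) * ∫⁻ z, (w z : ℝ≥0∞) ∂Q x := lintegral_const_mul _ hw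
      _ ≤ ((C ^ n : ℝ≥0) : ℝ≥0∞) * (C * w x) := by gcongr; exact hC x
      _ = _ := by rw [← mul_assoc, ← ENNReal.coe_mul, ← pow_succ]

/-- `S = κ - T` with `κ - T ≥ 0`: for all `x` and all measurable `A` one has `T(x, A) ≤ κ(x, A)`
and `S(x, A) = κ(x, A) - T(x, A)`. -/
structure IsNonnegDiff (S κ T : Kernel E E) : Prop where
  le : ∀ x A, MeasurableSet A → T x A ≤ κ x A
  eq : ∀ x A, MeasurableSet A → S x A = κ x A - T x A

theorem ActsOn.of_isNonnegDiff {w : Weight E} {S κ T : Kernel E E} (h : ActsOn w κ)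
    (hS : IsNonnegDiff S κ T) : ActsOn w S := by
  obtain ⟨C, hC⟩ := h
  refine ⟨C, fun x => (lintegral_mono' ?_ le_rfl).trans (hC x)⟩
  exact Measure.le_iff.2 fun A hA => (hS.eq x A hA).le.trans tsub_le_self

end WeightedKernel

open WeightedKernel

/-! Split `Q ^ l = S + T` with `T = T_{ν,α}`. A single `T` need not be compact on `Bw w`, since the
family of densities `α x ·` need not be relatively compact in L¹, but every `T S^k T` is compact
(`isCompactOperator_of_memHw`). Uniform integrability reduces this to bounded weighted densities.
The outer variable of the right-hand `T` is then integrated through the left-hand one, so its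
density matters only in L¹ of a finite product measure. There it can be approximated by sums of
products `a x * b y`, which give finite-rank operators.

In the expansion of `(S + T) ^ n` every word with two letters `T` is therefore compact, and the
other words have total norm `O(n a^n)` for each `a > r(S)`. Hence, for every `ρ > r(S)`, some power
of `S + T` is closer than `ρ ^ n` to a compact operator (`powNearCompact_add`).

`PowNearCompact.splitsAt` turns this into the required decomposition. Riesz's chain argument gives a
maximal finite-dimensional invariant `F` with eigenvalues of modulus at least `ρ`. By the Fredholm
alternative and maximality, the operator induced modulo `F` has spectral radius below `ρ`. If `J`
inverts the operator on `F` and `p` is any bounded projection onto `F`, the limit of `J^k p T^k`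
(with `T` now the operator being split) is a projection commuting with the operator, and its kernel
is `H`.

For `Q_χ`, averaging the product of the multipliers along a path, conditionally on its endpoints,
gives `Q_χ ^ l = (Q ^ l)_ξ` with `|ξ| ≤ ‖χ‖ ^ l` (`exists_twistedOp_pow`). Measurable conditional
densities are what countable generation provides; `l = 1` needs none. Then `ξ` twists both `S` and
`T`, positivity gives `r(S_ξ) ≤ ‖χ‖ ^ l r(S)`, and the argument above applies. Part (i) is the case
`ξ = 1`. -/

namespace WeightedKernel

/-! ### Growth of powers, and operators with a power close to a compact operator -/

section Operators

theorem eventually_norm_pow_le {A : Type*} [NormedRing A] [NormedAlgebra ℂ A] [CompleteSpace A]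
    {a : A} {r : ℝ≥0} (hr : spectralRadius ℂ a < r) : ∀ᶠ n : ℕ in atTop, ‖a ^ n‖ ≤ (r : ℝ) ^ n := by
  have h := (spectrum.pow_nnnorm_pow_one_div_tendsto_nhds_spectralRadius a).eventually_lt_const hr
  filter_upwards [h, eventually_gt_atTop 0] with n hn hn0
  have hn' : (n : ℝ) ≠ 0 := by positivity
  have := ENNReal.rpow_le_rpow hn.le (Nat.cast_nonneg (α := ℝ) n)
  rw [← ENNReal.rpow_mul, one_div, inv_mul_cancel₀ hn', ENNReal.rpow_one,
    ENNReal.rpow_natCast] at this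
  exact_mod_cast this

theorem exists_norm_pow_le {A : Type*} [NormedRing A] [NormedAlgebra ℂ A] [CompleteSpace A]
    {a : A} {r : ℝ≥0} (hr : spectralRadius ℂ a < r) : ∃ C : ℝ, 0 < C ∧ ∀ n, ‖a ^ n‖ ≤ C * (r : ℝ) ^ n := by
  obtain ⟨N, hN⟩ := eventually_atTop.1 (eventually_norm_pow_le hr)
  have hr0 : (0 : ℝ) < r := by exact_mod_cast (zero_le (a := spectralRadius ℂ a)).trans_lt hr
  refine ⟨1 + ∑ i ∈ Finset.range N, ‖a ^ i‖ / (r : ℝ) ^ i,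
    add_pos_of_pos_of_nonneg one_pos (Finset.sum_nonneg fun i _ => by positivity), fun n => ?_⟩
  have hs : 0 ≤ ∑ i ∈ Finset.range N, ‖a ^ i‖ / (r : ℝ) ^ i :=
    Finset.sum_nonneg fun i _ => by positivity
  rw [← div_le_iff₀ (by positivity)]
  rcases lt_or_ge n N with h | h
  · have := Finset.single_le_sum (f := fun i => ‖a ^ i‖ / (r : ℝ) ^ i)
      (fun i _ => by positivity) (Finset.mem_range.2 h)
    linarith
  · have : ‖a ^ n‖ / (r : ℝ) ^ n ≤ 1 := (div_le_one (by positivity)).2 (hN n h)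
    linarith

/-- If `z` is in the spectrum then `z ^ n` is in that of `a ^ n`, so `|z| ^ n` is at most a constant
times `r ^ n`. The factor `‖1‖` stays because the algebra may be trivial. -/
theorem spectralRadius_le_of_norm_pow_le {A : Type*} [NormedRing A] [NormedAlgebra ℂ A]
    [CompleteSpace A] {a : A} {r : ℝ≥0} {C : ℝ} (h : ∀ n, ‖a ^ n‖ ≤ C * (r : ℝ) ^ n) :
    spectralRadius ℂ a ≤ r := by
  refine le_of_forall_lt fun q hq => ?_
  by_contra! hrq
  obtain ⟨q', hq'1, hq'2⟩ := ENNReal.lt_iff_exists_nnreal_btwn.1 (hrq.trans_lt hq)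
  obtain ⟨z, hz, hzq⟩ : ∃ z ∈ spectrum ℂ a, q' < ‖z‖₊ := by
    simpa [spectralRadius, lt_iSup_iff] using hq'2
  have hrq' : (r : ℝ) < q' := by exact_mod_cast hq'1
  have hq0 : (0 : ℝ) < q' := r.2.trans_lt hrq'
  have hb : ∀ n : ℕ, 1 ≤ C * ‖(1 : A)‖ * ((r : ℝ) / q') ^ n := fun n => by
    have h1 := spectrum.norm_le_norm_mul_of_mem (spectrum.pow_mem_pow a n hz)
    rw [norm_pow] at h1
    have h2 : (q' : ℝ) ^ n ≤ ‖z‖ ^ n := pow_le_pow_left₀ hq0.le (by exact_mod_cast hzq.le) n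
    have h3 := mul_le_mul_of_nonneg_right (h n) (norm_nonneg (1 : A))
    rw [div_pow, mul_div_assoc', le_div_iff₀ (by positivity), one_mul]
    nlinarith
  have ht : Tendsto (fun n : ℕ => C * ‖(1 : A)‖ * ((r : ℝ) / q') ^ n) atTop (𝓝 (C * ‖(1 : A)‖ * 0)) :=
    (tendsto_pow_atTop_nhds_zero_of_lt_one (by positivity) ((div_lt_one hq0).2 hrq')).const_mul _
  rw [mul_zero] at ht
  exact absurd (ge_of_tendsto' ht hb) (by norm_num)

/-- Over `ℂ` the polynomial is a product of linear factors. If none of them had a kernel, their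
product could not kill `v`. No finite dimension is involved. -/
theorem exists_hasEigenvalue_of_aeval_eq_zero {V : Type*} [AddCommGroup V] [Module ℂ V]
    (f : Module.End ℂ V) {p : Polynomial ℂ} (hp : p ≠ 0) {v : V} (hv : v ≠ 0)
    (h : Polynomial.aeval f p v = 0) : ∃ μ, p.IsRoot μ ∧ f.HasEigenvalue μ := by
  by_contra! hne
  have key : ∀ s : Multiset ℂ, (∀ a ∈ s, ¬ f.HasEigenvalue a) → ∀ v,
      Polynomial.aeval f (s.map fun a => Polynomial.X - Polynomial.C a).prod v = 0 → v = 0 := by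
    intro s
    induction s using Multiset.induction_on with
    | empty => intro _ v hv; simpa using hv
    | cons a s ih =>
      intro hs v hv
      refine ih (fun b hb => hs b (Multiset.mem_cons_of_mem hb)) v ?_
      by_contra hv0
      refine hs a (Multiset.mem_cons_self a s)
        (Module.End.hasEigenvalue_of_hasEigenvector (x := _)
          ⟨Module.End.mem_eigenspace_iff.2 ?_, hv0⟩)
      rw [Multiset.map_cons, Multiset.prod_cons, map_mul, Module.End.mul_apply] at hv
      simpa [sub_eq_zero, Module.algebraMap_end_apply] using hv
  refine hv (key p.roots (fun a ha => hne a (Polynomial.isRoot_of_mem_roots ha)) v ?_)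
  rw [(IsAlgClosed.splits p).eq_prod_roots, map_mul, Module.End.mul_apply, Polynomial.aeval_C,
    Module.algebraMap_end_apply] at h
  exact (smul_eq_zero.1 h).resolve_left (by simpa using hp)

variable {B : Type*} [NormedAddCommGroup B] [NormedSpace ℂ B]

/-- Some positive power of `T` is within distance `ρ ^ n` of a compact operator. -/
def PowNearCompact (T : B →L[ℂ] B) (ρ : ℝ≥0) : Prop :=
  ∃ n : ℕ, 1 ≤ n ∧ ∃ K : B →L[ℂ] B, IsCompactOperator K ∧ ‖T ^ n - K‖ < (ρ : ℝ) ^ n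

/-- Compact operators form an ideal, so `T` and `T - K` have the same powers modulo compact
operators. -/
theorem exists_compact_pow_sub_pow (T K : B →L[ℂ] B) (hK : IsCompactOperator K) (m : ℕ) :
    ∃ K' : B →L[ℂ] B, IsCompactOperator K' ∧ T ^ m - K' = (T - K) ^ m := by
  induction m with
  | zero => exact ⟨0, isCompactOperator_zero, by simp⟩
  | succ m ih =>
    obtain ⟨K', hK', h⟩ := ih
    refine ⟨T * K' + K * (T ^ m - K'), ?_, ?_⟩
    · exact (hK'.clm_comp T).add (hK.comp_clm (T ^ m - K'))
    · rw [pow_succ' (T - K), ← h, pow_succ']; noncomm_ring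

theorem PowNearCompact.pos {T : B →L[ℂ] B} {ρ : ℝ≥0} (h : PowNearCompact T ρ) : 0 < ρ := by
  obtain ⟨n, hn, K, -, h⟩ := h
  rw [pos_iff_ne_zero]
  rintro rfl
  rw [NNReal.coe_zero, zero_pow (by omega)] at h
  exact (norm_nonneg _).not_gt h

/-- Passing to `m`-th powers replaces the ratio `‖T ^ n - K‖ / ρ ^ n < 1` by a bound tending to `0`.
This absorbs any fixed constant lost later. -/
theorem PowNearCompact.exists_lt {T : B →L[ℂ] B} {ρ : ℝ≥0} (h : PowNearCompact T ρ) {c : ℝ}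
    (hc : 0 < c) : ∃ n : ℕ, 1 ≤ n ∧ ∃ K : B →L[ℂ] B, IsCompactOperator K ∧
      ‖T ^ n - K‖ < c * (ρ : ℝ) ^ n := by
  have hρ : (0 : ℝ) < ρ := h.pos
  obtain ⟨n, hn, K, hK, h⟩ := h
  have h1 : ‖T ^ n - K‖ / (ρ : ℝ) ^ n < 1 := (div_lt_one (by positivity)).2 h
  have := tendsto_pow_atTop_nhds_zero_of_lt_one (by positivity) h1
  obtain ⟨m, hm, hm1⟩ := ((this.eventually_lt_const hc).and (eventually_ge_atTop 1)).exists
  obtain ⟨K', hK', h'⟩ := exists_compact_pow_sub_pow (T ^ n) K hK m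
  refine ⟨n * m, Nat.mul_pos hn hm1, K', hK', ?_⟩
  rw [pow_mul, h', pow_mul]
  rw [div_pow, div_lt_iff₀ (by positivity)] at hm
  exact (norm_pow_le' _ hm1).trans_lt hm

variable [CompleteSpace B]

/-- Since `‖T ^ n - K‖ < |z| ^ n`, the operator `u = z ^ n - (T ^ n - K)` is invertible and `z ^ n -
T ^ n = u (1 - u⁻¹ K)`. The Fredholm alternative for `u⁻¹ K` gives an eigenvector of `T ^ n` for `z
^ n`. Hence `T` has an eigenvalue `μ` with `μ ^ n = z ^ n`: its modulus is that of `z`, though it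
may differ from `z`. -/
theorem PowNearCompact.exists_hasEigenvalue {T : B →L[ℂ] B} {ρ : ℝ≥0} (h : PowNearCompact T ρ)
    {z : ℂ} (hz : z ∈ spectrum ℂ T) (hρz : ρ ≤ ‖z‖₊) :
    ∃ μ : ℂ, ρ ≤ ‖μ‖₊ ∧ Module.End.HasEigenvalue (T : B →ₗ[ℂ] B) μ := by
  have hρ := h.pos
  obtain ⟨n, hn, K, hK, h⟩ := h
  have hzn := spectrum.pow_mem_pow T n hz
  have hR : z ^ n ∈ resolventSet ℂ (T ^ n - K) := by
    refine spectrum.mem_resolventSet_of_norm_lt_mul ?_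
    calc ‖T ^ n - K‖ * ‖(1 : B →L[ℂ] B)‖ ≤ ‖T ^ n - K‖ * 1 := by
          gcongr; exact ContinuousLinearMap.norm_id_le
      _ < (ρ : ℝ) ^ n := by rwa [mul_one]
      _ ≤ ‖z‖ ^ n := pow_le_pow_left₀ ρ.2 (by exact_mod_cast hρz) n
      _ = _ := (norm_pow _ _).symm
  obtain ⟨u, hu⟩ := spectrum.mem_resolventSet_iff.1 hR
  have hc : IsCompactOperator ((↑u⁻¹ : B →L[ℂ] B) * K) := hK.clm_comp _
  rcases hc.hasEigenvalue_or_mem_resolventSet one_ne_zero with h1 | h1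
  · obtain ⟨v, hv⟩ := h1.exists_hasEigenvector
    have hv1 : (↑u⁻¹ : B →L[ℂ] B) (K v) = v := by simpa using hv.apply_eq_smul
    have hKv : K v = (u : B →L[ℂ] B) v := by
      conv_rhs => rw [← hv1, ← mul_apply_eq_comp, u.mul_inv]
      rfl
    have hTv : (T ^ n) v = z ^ n • v := by
      rw [hu] at hKv
      simp only [sub_apply, Algebra.algebraMap_eq_smul_one,
        smul_apply, one_apply_eq_self] at hKv
      exact sub_eq_zero.1 ((by abel : _ = _).trans (sub_eq_zero.2 hKv))
    obtain ⟨μ, hμ, hev⟩ := exists_hasEigenvalue_of_aeval_eq_zero (T : B →ₗ[ℂ] B)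
      (p := Polynomial.X ^ n - Polynomial.C (z ^ n)) (Polynomial.X_pow_sub_C_ne_zero hn _)
      hv.2 (by
        have : ((T : B →ₗ[ℂ] B) ^ n) v = (T ^ n) v := by
          rw [← ContinuousLinearMap.toLinearMap_pow]; rfl
        rw [map_sub, map_pow, Polynomial.aeval_X, Polynomial.aeval_C, LinearMap.sub_apply, this, hTv,
          Module.algebraMap_end_apply, sub_self])
    refine ⟨μ, ?_, hev⟩
    have : μ ^ n = z ^ n := by simpa [sub_eq_zero] using hμ
    have h2 : ‖μ‖₊ ^ n = ‖z‖₊ ^ n := by rw [← nnnorm_pow, this, nnnorm_pow]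
    rwa [(pow_left_inj₀ zero_le zero_le (by omega)).1 h2]
  · refine absurd ?_ hzn
    obtain ⟨v, hv⟩ := spectrum.mem_resolventSet_iff.1 h1
    refine spectrum.mem_resolventSet_iff.2 ⟨u * v, ?_⟩
    rw [Units.val_mul, hv, mul_sub, map_one, mul_one, ← mul_assoc, u.mul_inv, one_mul, hu]
    abel

end Operators

/-! ### Riesz theory: the maximal peripheral subspace -/

section Splitting

variable {B : Type*} [NormedAddCommGroup B] [NormedSpace ℂ B]

/-- A finite-dimensional invariant subspace all of whose eigenvalues have modulus at least `ρ`. -/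
structure IsPeripheral (T : B →L[ℂ] B) (ρ : ℝ≥0) (F : Submodule ℂ B) : Prop where
  finite : FiniteDimensional ℂ F
  map_mem : ∀ f ∈ F, T f ∈ F
  le_nnnorm : ∀ f ∈ F, f ≠ 0 → ∀ z : ℂ, T f = z • f → ρ ≤ ‖z‖₊

theorem isPeripheral_bot (T : B →L[ℂ] B) (ρ : ℝ≥0) : IsPeripheral T ρ ⊥ where
  finite := inferInstance
  map_mem f hf := by simp [(Submodule.mem_bot ℂ).1 hf]
  le_nnnorm f hf h0 := absurd ((Submodule.mem_bot ℂ).1 hf) h0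

/-- Modulo `F` the operator acts on the new vector as the scalar `l`, so an eigenvector outside `F`
can only have eigenvalue `l`. -/
theorem IsPeripheral.sup_span {T : B →L[ℂ] B} {ρ : ℝ≥0} {F : Submodule ℂ B}
    (hF : IsPeripheral T ρ F) {x : B} (hx : x ∉ F) {l : ℂ} (hl : ρ ≤ ‖l‖₊)
    (h : T x - l • x ∈ F) : IsPeripheral T ρ (F ⊔ Submodule.span ℂ {x}) where
  finite := by have := hF.finite; infer_instance
  map_mem f hf := by
    obtain ⟨y, hy, w, hw, rfl⟩ := Submodule.mem_sup.1 hf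
    obtain ⟨c, rfl⟩ := Submodule.mem_span_singleton.1 hw
    refine Submodule.mem_sup.2 ⟨T y + c • (T x - l • x),
      F.add_mem (hF.map_mem y hy) (F.smul_mem c h), (c * l) • x,
      Submodule.mem_span_singleton.2 ⟨_, rfl⟩, ?_⟩
    rw [map_add, map_smul, smul_sub, smul_smul]
    abel
  le_nnnorm f hf h0 z hz := by
    obtain ⟨y, hy, w, hw, rfl⟩ := Submodule.mem_sup.1 hf
    obtain ⟨c, rfl⟩ := Submodule.mem_span_singleton.1 hw
    by_cases hc : c * (l - z) = 0
    · rcases mul_eq_zero.1 hc with rfl | hlz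
      · rw [zero_smul, add_zero] at hz h0
        exact hF.le_nnnorm y hy h0 z hz
      · rwa [← sub_eq_zero.1 hlz]
    · refine absurd ((F.smul_mem_iff hc).1 ?_) hx
      have : (c * (l - z)) • x = z • y - T y - c • (T x - l • x) := by
        rw [map_add, map_smul, smul_add] at hz
        rw [smul_sub, mul_sub, sub_smul, mul_smul, mul_smul, smul_comm c z x,
          sub_sub, ← add_sub_assoc, hz]
        abel
      rw [this]
      exact F.sub_mem (F.sub_mem (F.smul_mem z hy) (hF.map_mem y hy)) (F.smul_mem c h)

theorem exists_riesz_vector {F G : Submodule ℂ B} (hF : IsClosed (F : Set B)) (h : F < G) :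
    ∃ u ∈ G, ‖u‖ = 1 ∧ ∀ y ∈ F, 1 / 2 ≤ ‖u - y‖ := by
  obtain ⟨x, hxG, hxF⟩ := SetLike.exists_of_lt h
  obtain ⟨u, -, hu1, hu⟩ := riesz_lemma_of_lt_one (F := F.comap G.subtype)
    (hF.preimage continuous_subtype_val) ⟨⟨x, hxG⟩, hxF⟩ (r := 1 / 2) (by norm_num)
  exact ⟨u, u.2, hu1, fun y hy => hu ⟨y, h.le hy⟩ hy⟩

/-- Riesz's argument: choose unit vectors `u k` in `F (k + 1)` at distance at least `1 / 2` from `F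
k`. As `T ^ n` acts on `F (k + 1)` modulo `F k` as `l k ^ n`, the images are `ρ ^ n / 2`-separated,
whereas a compact `K` close to `T ^ n` makes a subsequence cluster. -/
theorem PowNearCompact.not_exists_chain {T : B →L[ℂ] B} {ρ : ℝ≥0} (h : PowNearCompact T ρ)
    (F : ℕ → Submodule ℂ B) (hfin : ∀ k, FiniteDimensional ℂ (F k)) (hF : StrictMono F)
    (hT : ∀ k, ∀ f ∈ F k, T f ∈ F k) (l : ℕ → ℂ) (hl : ∀ k, ρ ≤ ‖l k‖₊)
    (hFl : ∀ k, ∀ f ∈ F (k + 1), T f - l k • f ∈ F k) : False := by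
  have hρ : (0 : ℝ) < ρ := h.pos
  -- Two errors from `T ^ n - K` and one Cauchy error, each at most `ρ ^ n / 8`, stay below the
  -- separation `ρ ^ n / 2`.
  obtain ⟨n, hn, K, hK, hTK⟩ := h.exists_lt (c := 1 / 8) (by norm_num)
  have hpow : ∀ m k, ∀ f ∈ F k, (T ^ m) f ∈ F k := by
    intro m k
    induction m with
    | zero => intro f hf; simpa using hf
    | succ m ih => intro f hf; rw [pow_succ]; exact ih _ (hT k f hf)
  have hlpow : ∀ m k, ∀ f ∈ F (k + 1), (T ^ m) f - l k ^ m • f ∈ F k := by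
    intro m k
    induction m with
    | zero => intro f _; simp
    | succ m ih =>
      intro f hf
      have h1 := (F k).add_mem (hpow m k _ (hFl k f hf)) ((F k).smul_mem (l k) (ih f hf))
      rw [map_sub, map_smul, smul_sub, smul_smul, ← pow_succ'] at h1
      rw [pow_succ]
      change (T ^ m) (T f) - _ ∈ _
      simpa using h1
  have hcl : ∀ k, IsClosed (F k : Set B) := fun k => by
    have := hfin k
    exact Submodule.closed_of_finiteDimensional _
  choose u huF hu1 hu using fun k => exists_riesz_vector (hcl k) (hF (Nat.lt_succ_self k))
  have hsep : ∀ j k, j < k → (ρ : ℝ) ^ n / 2 ≤ ‖(T ^ n) (u k) - (T ^ n) (u j)‖ := by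
    intro j k hjk
    have hl0 : (ρ : ℝ) ^ n ≤ ‖l k ^ n‖ := by
      rw [norm_pow]; exact pow_le_pow_left₀ ρ.2 (by exact_mod_cast hl k) n
    have hne : l k ^ n ≠ 0 := norm_pos_iff.1 ((by positivity : (0 : ℝ) < (ρ : ℝ) ^ n).trans_le hl0)
    have hy : (T ^ n) (u j) - ((T ^ n) (u k) - l k ^ n • u k) ∈ F k :=
      (F k).sub_mem (hpow n k _ (hF.monotone hjk (huF j))) (hlpow n k _ (huF k))
    have := hu k _ ((F k).smul_mem (l k ^ n)⁻¹ hy)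
    have heq : (T ^ n) (u k) - (T ^ n) (u j) =
        l k ^ n • (u k - (l k ^ n)⁻¹ • ((T ^ n) (u j) - ((T ^ n) (u k) - l k ^ n • u k))) := by
      rw [smul_sub, smul_inv_smul₀ hne]; abel
    rw [heq, norm_smul]
    calc (ρ : ℝ) ^ n / 2 = (ρ : ℝ) ^ n * (1 / 2) := by ring
      _ ≤ _ := mul_le_mul hl0 this (by norm_num) (norm_nonneg _)
  obtain ⟨C, hC, hKC⟩ := hK.image_closedBall_subset_compact 1
  obtain ⟨a, -, φ, hφ, hlim⟩ := hC.tendsto_subseq (x := fun k => K (u k))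
    (fun k => hKC ⟨u k, by simp [hu1 k], rfl⟩)
  obtain ⟨N, hN⟩ := Metric.cauchySeq_iff.1 hlim.cauchySeq ((ρ : ℝ) ^ n / 8) (by positivity)
  have h1 := hN (N + 1) (by omega) N le_rfl
  have h2 := hsep _ _ (hφ (Nat.lt_succ_self N))
  have hb : ∀ k, ‖(T ^ n - K) (u k)‖ ≤ 1 / 8 * (ρ : ℝ) ^ n := fun k => by
    simpa [hu1 k] using ((T ^ n - K).le_opNorm (u k)).trans
      (mul_le_mul_of_nonneg_right hTK.le (norm_nonneg _))
  have heq : (T ^ n) (u (φ (N + 1))) - (T ^ n) (u (φ N)) = (T ^ n - K) (u (φ (N + 1))) -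
      (T ^ n - K) (u (φ N)) + (K (u (φ (N + 1))) - K (u (φ N))) := by
    simp only [sub_apply]; abel
  have h3 : ‖(T ^ n) (u (φ (N + 1))) - (T ^ n) (u (φ N))‖ ≤ 1 / 8 * (ρ : ℝ) ^ n +
      1 / 8 * (ρ : ℝ) ^ n + (ρ : ℝ) ^ n / 8 := by
    rw [heq]
    refine (norm_add_le _ _).trans (add_le_add ((norm_sub_le _ _).trans
      (add_le_add (hb _) (hb _))) ?_)
    simpa [dist_eq_norm] using h1.le
  have : (0 : ℝ) < (ρ : ℝ) ^ n := by positivity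
  rw [Nat.succ_eq_add_one] at h2
  linarith

/-- Otherwise adjoining generalized eigenvectors one at a time, starting from `⊥`, would produce the
forbidden infinite chain. -/
theorem PowNearCompact.exists_maximal_isPeripheral {T : B →L[ℂ] B} {ρ : ℝ≥0}
    (h : PowNearCompact T ρ) : ∃ F : Submodule ℂ B, IsPeripheral T ρ F ∧
      ∀ x ∉ F, ∀ l : ℂ, ρ ≤ ‖l‖₊ → T x - l • x ∉ F := by
  by_contra! hne
  choose! x hx l hl hxl using hne
  let F : ℕ → {F : Submodule ℂ B // IsPeripheral T ρ F} := fun k =>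
    Nat.rec ⟨⊥, isPeripheral_bot T ρ⟩ (fun _ F => ⟨F.1 ⊔ Submodule.span ℂ {x F.1},
      F.2.sup_span (hx _ F.2) (hl _ F.2) (hxl _ F.2)⟩) k
  have hsucc : ∀ k, (F (k + 1)).1 = (F k).1 ⊔ Submodule.span ℂ {x (F k).1} := fun k => rfl
  refine h.not_exists_chain (fun k => (F k).1) (fun k => (F k).2.finite)
    (strictMono_nat_of_lt_succ fun k => ?_) (fun k => (F k).2.map_mem) (fun k => l (F k).1)
    (fun k => hl _ (F k).2) (fun k f hf => ?_)
  · rw [hsucc]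
    refine lt_of_le_of_ne le_sup_left fun he => hx _ (F k).2 ?_
    exact he.ge (Submodule.mem_sup_right (Submodule.mem_span_singleton_self _))
  · rw [hsucc] at hf
    obtain ⟨y, hy, w, hw, rfl⟩ := Submodule.mem_sup.1 hf
    obtain ⟨c, rfl⟩ := Submodule.mem_span_singleton.1 hw
    have := (F k).1.add_mem ((F k).1.sub_mem ((F k).2.map_mem y hy)
      ((F k).1.smul_mem (l (F k).1) hy)) ((F k).1.smul_mem c (hxl _ (F k).2))
    convert this using 1
    rw [map_add, map_smul, smul_add, smul_sub, smul_comm c]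
    abel

/-- As `ρ > 0`, zero is not an eigenvalue on `F`, so the restriction is invertible by finite
dimension. The nonzero spectrum of the inverse consists of reciprocals of eigenvalues. -/
theorem IsPeripheral.exists_inverse {T : B →L[ℂ] B} {ρ : ℝ≥0} (hρ : 0 < ρ) {F : Submodule ℂ B}
    (hF : IsPeripheral T ρ F) : ∃ J : F →L[ℂ] F, J * T.restrict hF.map_mem = 1 ∧
      T.restrict hF.map_mem * J = 1 ∧ spectralRadius ℂ J ≤ (ρ⁻¹ : ℝ≥0) := by
  have := hF.finite
  have hinj : Function.Injective (T.restrict hF.map_mem : F →ₗ[ℂ] F) := by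
    rw [← LinearMap.ker_eq_bot, LinearMap.ker_eq_bot']
    intro f hf
    by_contra h0
    have := hF.le_nnnorm f f.2 (by simpa using h0) 0 (by simpa using congrArg Subtype.val hf)
    simp at this
    exact hρ.ne' this
  let e := (LinearEquiv.ofInjectiveEndo _ hinj).toContinuousLinearEquiv
  have he : ∀ f, e f = T.restrict hF.map_mem f := fun f => rfl
  have h1 : (e.symm : F →L[ℂ] F) * T.restrict hF.map_mem = 1 := by
    ext1 f; change e.symm (T.restrict hF.map_mem f) = f; rw [← he, e.symm_apply_apply]
  have h2 : T.restrict hF.map_mem * (e.symm : F →L[ℂ] F) = 1 := by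
    ext1 f; change T.restrict hF.map_mem (e.symm f) = f; rw [← he, e.apply_symm_apply]
  refine ⟨e.symm, h1, h2, iSup₂_le fun z hz => ?_⟩
  rcases eq_or_ne z 0 with rfl | hz0
  · simp
  have hcpt : IsCompactOperator (e.symm : F →L[ℂ] F) :=
    isCompactOperator_of_locallyCompactSpace_dom (e.symm : F →L[ℂ] F)
  obtain ⟨v, hv⟩ := ((hcpt.hasEigenvalue_iff_mem_spectrum hz0).2 hz).exists_hasEigenvector
  have hv1 : (e.symm : F →L[ℂ] F) v = z • v := hv.apply_eq_smul
  have hv2 : T.restrict hF.map_mem v = z⁻¹ • v := by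
    have h3 : T.restrict hF.map_mem ((e.symm : F →L[ℂ] F) v) = v := by
      rw [← mul_apply_eq_comp, h2]; rfl
    rw [hv1, map_smul] at h3
    rw [eq_inv_smul_iff₀ hz0, h3]
  have := hF.le_nnnorm v v.2 (by simpa using hv.2) z⁻¹ (by simpa using congrArg Subtype.val hv2)
  rw [nnnorm_inv] at this
  exact_mod_cast (le_inv_comm₀ hρ (by simpa using hz0)).1 this

variable [CompleteSpace B]

/-- A spectral point of modulus at least `ρ` would yield an eigenvalue of the same kind. Strictness
comes from compactness of the spectrum, which is empty only on the trivial space. -/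
theorem PowNearCompact.spectralRadius_lt {T : B →L[ℂ] B} {ρ : ℝ≥0} (h : PowNearCompact T ρ)
    (hne : ∀ x ≠ 0, ∀ z : ℂ, T x = z • x → ‖z‖₊ < ρ) : spectralRadius ℂ T < ρ := by
  have key : ∀ z ∈ spectrum ℂ T, ‖z‖₊ < ρ := by
    intro z hz
    by_contra! hρz
    obtain ⟨μ, hμ, hev⟩ := h.exists_hasEigenvalue hz hρz
    obtain ⟨v, hv⟩ := hev.exists_hasEigenvector
    exact (hne v hv.2 μ hv.apply_eq_smul).not_ge hμ
  rcases (spectrum ℂ T).eq_empty_or_nonempty with he | he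
  · simpa [spectralRadius, he] using h.pos
  · exact spectrum.spectralRadius_lt_of_forall_lt_of_nonempty he key

end Splitting

/-! ### From near-compact powers to the invariant splitting; perturbation by `T` -/

section EssentialRadius

variable {B : Type*} [NormedAddCommGroup B] [NormedSpace ℂ B]

theorem _root_.IsCompactOperator.mul_left {K : B →L[ℂ] B} (hK : IsCompactOperator K)
    (T : B →L[ℂ] B) : IsCompactOperator (T * K : B →L[ℂ] B) :=
  hK.clm_comp T

/-- When `p` projects onto an invariant subspace, `(1 - p) * T` models the operator induced on the
quotient. The hypothesis expresses invariance. -/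
theorem one_sub_proj_mul_pow {T p : B →L[ℂ] B} (h : (1 - p) * T * p = 0) (n : ℕ) :
    (1 - p) * T ^ n = ((1 - p) * T) ^ n * (1 - p) := by
  have h1 : (1 - p) * T = (1 - p) * T * (1 - p) := by rw [mul_sub, h, mul_one, sub_zero]
  induction n with
  | zero => simp
  | succ n ih =>
    rw [pow_succ' T, ← mul_assoc, pow_succ', mul_assoc _ (_ ^ n), ← ih, ← mul_assoc, ← h1]

theorem compression_pow {T p : B →L[ℂ] B} (h : (1 - p) * T * p = 0) {n : ℕ} (hn : 1 ≤ n) :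
    ((1 - p) * T) ^ n = (1 - p) * T ^ n := by
  obtain ⟨m, rfl⟩ := Nat.exists_eq_add_of_le' hn
  rw [pow_succ, pow_succ, ← mul_assoc, ← mul_assoc, one_sub_proj_mul_pow h]

theorem PowNearCompact.compression {T p : B →L[ℂ] B} {ρ : ℝ≥0} (hT : PowNearCompact T ρ)
    (h : (1 - p) * T * p = 0) : PowNearCompact ((1 - p) * T) ρ := by
  obtain ⟨n, hn, K, hK, hTK⟩ := hT.exists_lt (c := (1 + ‖1 - p‖)⁻¹) (by positivity)
  refine ⟨n, hn, (1 - p) * K, hK.mul_left (1 - p), ?_⟩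
  have hρ : (0 : ℝ) < ρ := hT.pos
  rw [compression_pow h hn, ← mul_sub]
  calc ‖(1 - p) * (T ^ n - K)‖ ≤ ‖1 - p‖ * ‖T ^ n - K‖ := norm_mul_le _ _
    _ ≤ (1 + ‖1 - p‖) * ‖T ^ n - K‖ := by gcongr; linarith
    _ < (1 + ‖1 - p‖) * ((1 + ‖1 - p‖)⁻¹ * (ρ : ℝ) ^ n) := by gcongr
    _ = (ρ : ℝ) ^ n := by rw [mul_inv_cancel_left₀ (by positivity)]

theorem PowNearCompact.of_pow {T : B →L[ℂ] B} {ρ : ℝ≥0} {l : ℕ} (hl : 1 ≤ l)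
    (h : PowNearCompact (T ^ l) (ρ ^ l)) : PowNearCompact T ρ := by
  obtain ⟨n, hn, K, hK, h⟩ := h
  exact ⟨l * n, Nat.mul_pos hl hn, K, hK, by simpa [pow_mul] using h⟩

/-- A word in `S` and `T` with at least two letters `T` contains some `T * S ^ k * T`, hence is
compact. Only the words with at most one `T` are kept explicitly. -/
theorem exists_compact_add_pow {S T : B →L[ℂ] B} (h : ∀ k : ℕ, IsCompactOperator (T * S ^ k * T : B →L[ℂ] B))
    (n : ℕ) : ∃ K : B →L[ℂ] B, IsCompactOperator K ∧ (S + T) ^ n =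
      S ^ n + ∑ i ∈ Finset.range n, S ^ i * T * S ^ (n - 1 - i) + K := by
  induction n with
  | zero => exact ⟨0, isCompactOperator_zero, by simp⟩
  | succ n ih =>
    obtain ⟨K, hK, ih⟩ := ih
    have hX : IsCompactOperator
        (T * ∑ i ∈ Finset.range n, S ^ i * T * S ^ (n - 1 - i) : B →L[ℂ] B) := by
      rw [Finset.mul_sum]
      refine (compactOperator (RingHom.id ℂ) B B).sum_mem fun i _ => ?_
      have := (h i).comp_clm (S ^ (n - 1 - i))
      rw [← mul_assoc, ← mul_assoc]
      exact this
    refine ⟨(S + T) * K + T * ∑ i ∈ Finset.range n, S ^ i * T * S ^ (n - 1 - i),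
      (hK.clm_comp (S + T)).add hX, ?_⟩
    rw [pow_succ' (S + T), ih, Finset.sum_range_succ', pow_zero, one_mul, Nat.add_sub_cancel,
      Nat.sub_zero]
    have : ∑ i ∈ Finset.range n, S ^ (i + 1) * T * S ^ (n - (i + 1)) =
        S * ∑ i ∈ Finset.range n, S ^ i * T * S ^ (n - 1 - i) := by
      rw [Finset.mul_sum]
      refine Finset.sum_congr rfl fun i _ => ?_
      rw [pow_succ', ← mul_assoc, ← mul_assoc, ← Nat.sub_sub, Nat.sub_right_comm]
    rw [this, pow_succ' S]
    noncomm_ring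

theorem compression_mul_proj {F : Type*} [NormedAddCommGroup F] [NormedSpace ℂ F] {T : B →L[ℂ] B} {A : F →L[ℂ] F} {ι : F →L[ℂ] B} {p : B →L[ℂ] F}
    (hp : ∀ f, p (ι f) = f) (hT : ∀ f, T (ι f) = ι (A f)) :
    (1 - ι ∘L p) * T * (ι ∘L p) = 0 := by
  ext1 x
  change T (ι (p x)) - ι (p (T (ι (p x)))) = 0
  rw [hT, hp, sub_self]

variable [CompleteSpace B]

/-- The projection is the limit of `P k = J ^ k p T ^ k`. Each `P k` is the identity on `F` and
satisfies `P k T = A P (k + 1)`, so a limit commutes with the dynamics. Convergence is geometric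
because `J` grows at rate at most `ρ⁻¹` and the compression at a rate below `ρ`. -/
theorem exists_intertwining {F : Type*} [NormedAddCommGroup F] [NormedSpace ℂ F] [CompleteSpace F]
    {T : B →L[ℂ] B} {A J : F →L[ℂ] F} {ι : F →L[ℂ] B} {p : B →L[ℂ] F}
    (hp : ∀ f, p (ι f) = f) (hT : ∀ f, T (ι f) = ι (A f)) (hJA : J * A = 1) (hAJ : A * J = 1)
    {ρ : ℝ≥0} (hJ : spectralRadius ℂ J ≤ (ρ⁻¹ : ℝ≥0))
    (hr : spectralRadius ℂ ((1 - ι ∘L p) * T) < ρ) :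
    ∃ P : B →L[ℂ] F, (∀ f, P (ι f) = f) ∧ ∀ x, P (T x) = A (P x) := by
  have hqT := compression_mul_proj hp hT
  obtain ⟨a, ha1, ha2⟩ := ENNReal.lt_iff_exists_nnreal_btwn.1 hr
  -- `a` controls powers of the compression and `b⁻¹ > ρ⁻¹` those of `J`, so the increments of `P`
  -- have ratio `a / b < 1`.
  obtain ⟨b, hab, hbρ⟩ := exists_between (ENNReal.coe_lt_coe.1 ha2)
  have hb0 : 0 < b := zero_le.trans_lt hab
  obtain ⟨C, hC0, hC⟩ := exists_norm_pow_le ha1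
  obtain ⟨D, hD0, hD⟩ := exists_norm_pow_le (a := J) (r := b⁻¹)
    (hJ.trans_lt (ENNReal.coe_lt_coe.2 (inv_strictAnti₀ hb0 hbρ)))
  have hJApow : ∀ k, J ^ k * A ^ k = 1 := fun k => by
    have hc : Commute J A := hJA.trans hAJ.symm
    rw [← hc.mul_pow, hJA, one_pow]
  have hTpow : ∀ k f, (T ^ k) (ι f) = ι ((A ^ k) f) := by
    intro k
    induction k with
    | zero => simp
    | succ k ih =>
      intro f
      rw [pow_succ, pow_succ, mul_apply_eq_comp, mul_apply_eq_comp, hT, ih]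
  let P : ℕ → (B →L[ℂ] F) := fun k => (J ^ k) ∘L (p ∘L (T ^ k))
  have hPapp : ∀ k x, P k x = (J ^ k) (p ((T ^ k) x)) := fun _ _ => rfl
  have hPf : ∀ k f, P k (ι f) = f := fun k f => by
    rw [hPapp, hTpow, hp, ← mul_apply_eq_comp, hJApow, one_apply_eq_self]
  have hPT : ∀ k x, P k (T x) = A (P (k + 1) x) := fun k x => by
    rw [hPapp, hPapp, ← mul_apply_eq_comp A, pow_succ' J, ← mul_assoc, hAJ, one_mul, pow_succ T,
      mul_apply_eq_comp]
  -- `R` is the failure of `p` to intertwine `T` and `A`. It vanishes on `F`, so it factors through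
  -- `1 - ι ∘L p`, and the increments of `P` see only the compression.
  obtain ⟨R, hR⟩ : ∃ R : B →L[ℂ] F, ∀ x, R x = p (T x) - A (p x) :=
    ⟨p ∘L T - A ∘L p, fun _ => rfl⟩
  have hRq : ∀ x, R ((1 - ι ∘L p) x) = R x := fun x => by
    have : R (ι (p x)) = 0 := by rw [hR, hp, hT, hp, sub_self]
    change R (x - ι (p x)) = R x
    rw [map_sub, this, sub_zero]
  have hdiff : ∀ k, P (k + 1) - P k =
      (J ^ (k + 1)) ∘L (R ∘L ((((1 - ι ∘L p) * T) ^ k) * (1 - ι ∘L p))) := by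
    intro k
    have h2 : J ^ (k + 1) * A = J ^ k := by rw [pow_succ, mul_assoc, hJA, mul_one]
    rw [← one_sub_proj_mul_pow hqT k]
    ext1 x
    rw [sub_apply, hPapp, hPapp, ContinuousLinearMap.comp_apply, ContinuousLinearMap.comp_apply,
      mul_apply_eq_comp, hRq, hR, map_sub, ← mul_apply_eq_comp (J ^ (k + 1)) A, h2,
      pow_succ' T, mul_apply_eq_comp]
  have hbd : ∀ k, dist (P k) (P (k + 1)) ≤
      (D * (b : ℝ)⁻¹ * ‖R‖ * C * ‖1 - ι ∘L p‖) * ((a : ℝ) / b) ^ k := by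
    intro k
    rw [dist_comm, dist_eq_norm, hdiff]
    calc _ ≤ ‖J ^ (k + 1)‖ * (‖R‖ * (‖((1 - ι ∘L p) * T) ^ k‖ * ‖1 - ι ∘L p‖)) := by
          refine (ContinuousLinearMap.opNorm_comp_le _ _).trans ?_
          gcongr
          refine (ContinuousLinearMap.opNorm_comp_le _ _).trans ?_
          gcongr
          exact norm_mul_le _ _
      _ ≤ (D * ((b⁻¹ : ℝ≥0) : ℝ) ^ (k + 1)) * (‖R‖ * (C * (a : ℝ) ^ k * ‖1 - ι ∘L p‖)) := by
          gcongr
          · exact hD _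
          · exact hC _
      _ = _ := by rw [NNReal.coe_inv, div_pow, pow_succ, inv_pow]; ring
  obtain ⟨Q, hQ⟩ := cauchySeq_tendsto_of_complete (cauchySeq_of_le_geometric _ _
    ((div_lt_one (by exact_mod_cast hb0)).2 (by exact_mod_cast hab)) hbd)
  have hQx : ∀ x, Tendsto (fun k => P k x) atTop (𝓝 (Q x)) := fun x =>
    ((ContinuousLinearMap.apply ℂ F x).continuous.tendsto Q).comp hQ
  refine ⟨Q, fun f => ?_, fun x => ?_⟩
  · exact tendsto_nhds_unique (hQx (ι f)) (by simp only [hPf]; exact tendsto_const_nhds)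
  · refine tendsto_nhds_unique (hQx (T x)) ?_
    simp only [hPT]
    exact (A.continuous.tendsto _).comp ((hQx x).comp (tendsto_add_atTop_nat 1))

/-- The maps `q` and `L` transfer growth bounds: `R ^ n` corresponds to `L A ^ n q` on the image of
`ι`. This identifies the kernel of the final projection with the quotient by `F`, up to equivalent
norms. -/
theorem spectralRadius_lt_of_isometry {X : Type*} [NormedAddCommGroup X] [NormedSpace ℂ X]
    [CompleteSpace X] {T A L q : B →L[ℂ] B} (hA : ∀ n, q * T ^ n = A ^ n * q) {R : X →L[ℂ] X}
    {ι : X → B} (hι : ∀ x, ‖ι x‖ = ‖x‖) (hR : ∀ x, ι (R x) = T (ι x))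
    (hL : ∀ x, L (q (ι x)) = ι x) {ρ : ℝ≥0} (hr : spectralRadius ℂ A < ρ) :
    spectralRadius ℂ R < ρ := by
  obtain ⟨a, ha1, ha2⟩ := ENNReal.lt_iff_exists_nnreal_btwn.1 hr
  obtain ⟨C, hC0, hC⟩ := exists_norm_pow_le ha1
  have hpow : ∀ (m : ℕ) x, ι ((R ^ m) x) = (T ^ m) (ι x) := by
    intro m
    induction m with
    | zero => simp
    | succ m ih =>
      intro y
      rw [pow_succ, pow_succ, mul_apply_eq_comp, mul_apply_eq_comp, ih, hR]
  have key : ∀ n, ‖R ^ n‖ ≤ ‖L‖ * C * ‖q‖ * (a : ℝ) ^ n := fun n => by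
    refine ContinuousLinearMap.opNorm_le_bound (R ^ n) (by positivity) fun x => ?_
    have hx : ι ((R ^ n) x) = L ((A ^ n) (q (ι x))) := by
      rw [← hL, hpow, ← mul_apply_eq_comp q, hA, mul_apply_eq_comp]
    rw [← hι, hx, ← hι x]
    calc _ ≤ ‖L‖ * (‖A ^ n‖ * (‖q‖ * ‖ι x‖)) :=
          L.le_opNorm_of_le ((A ^ n).le_opNorm_of_le (q.le_opNorm _))
      _ ≤ ‖L‖ * (C * (a : ℝ) ^ n * (‖q‖ * ‖ι x‖)) := by
          gcongr; exact hC n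
      _ = _ := by ring
  exact (spectralRadius_le_of_norm_pow_le key).trans_lt ha2

theorem IsPeripheral.splitsAt {T : B →L[ℂ] B} {ρ : ℝ≥0} (hρ : 0 < ρ)
    {F : Submodule ℂ B} (hF : IsPeripheral T ρ F) {p : B →L[ℂ] F} (hp : ∀ f : F, p f = f)
    (hr : spectralRadius ℂ ((1 - F.subtypeL ∘L p) * T) < ρ) : SplitsAt T ρ := by
  have hfin := hF.finite
  have : CompleteSpace F := FiniteDimensional.complete ℂ F
  obtain ⟨J, hJA, hAJ, hJ⟩ := hF.exists_inverse hρ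
  obtain ⟨P, hP, hPT⟩ := exists_intertwining (ι := F.subtypeL) hp (fun _ => rfl) hJA hAJ hJ hr
  have hH : ∀ x ∈ P.ker, T x ∈ P.ker := fun x hx => by
    have hx : P x = 0 := hx
    change P (T x) = 0
    rw [hPT, hx, map_zero]
  -- Both `p` and `P` project onto `F`, so subtracting the `P`-component undoes the shift by `p y`,
  -- which lies in `F`.
  have hfix : ∀ y ∈ P.ker,
      (1 - F.subtypeL ∘L P) ((1 - F.subtypeL ∘L p) y) = y := fun y hy => by
    have hy : P y = 0 := hy
    change (y - (p y : B)) - (P (y - (p y : B)) : B) = y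
    rw [map_sub, show P (p y : B) = p y from hP (p y), hy, zero_sub, Submodule.coe_neg]
    abel
  have hq := compression_mul_proj (ι := F.subtypeL) (A := T.restrict hF.map_mem) hp fun _ => rfl
  have : CompleteSpace P.ker := P.isClosed_ker.completeSpace_coe
  have hlt : spectralRadius ℂ (T.restrict hH) < ρ :=
    spectralRadius_lt_of_isometry (one_sub_proj_mul_pow hq) (ι := Subtype.val) (fun _ => rfl)
      (fun _ => rfl) (fun y => hfix y y.2) hr
  refine ⟨F, P.ker, hF.map_mem, hH, LinearMap.isCompl_of_proj hP, P.isClosed_ker,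
    hlt, hfin, fun z hz => ?_⟩
  obtain ⟨v, hv⟩ := hz.exists_hasEigenvector
  exact hF.le_nnnorm v v.2 (by simpa using hv.2) z (congrArg Subtype.val hv.apply_eq_smul)

theorem PowNearCompact.splitsAt {T : B →L[ℂ] B} {ρ : ℝ≥0} (h : PowNearCompact T ρ) :
    SplitsAt T ρ := by
  obtain ⟨F, hF, hmax⟩ := h.exists_maximal_isPeripheral
  have hfin := hF.finite
  obtain ⟨p, hp⟩ := Submodule.ClosedComplemented.of_finiteDimensional (𝕜 := ℂ) F
  refine hF.splitsAt h.pos hp (PowNearCompact.spectralRadius_lt (h.compression ?_) ?_)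
  · exact compression_mul_proj (ι := F.subtypeL) (A := T.restrict hF.map_mem) hp fun _ => rfl
  · intro x hx0 z hz
    by_contra! hρz
    -- An eigenvector of the compression is an eigenvector of `T` modulo `F`. Maximality puts it in
    -- `F`, where the compression vanishes.
    have hz' : T x - z • x = p (T x) := by
      rw [← hz]; simp
    refine hmax x (fun hxF => hx0 ?_) z hρz (hz' ▸ (p (T x)).2)
    have h1 : p (T x) = (⟨T x, hF.map_mem x hxF⟩ : F) := hp ⟨T x, hF.map_mem x hxF⟩
    rw [h1] at hz'
    have h2 : z • x = 0 := by simpa using hz'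
    refine (smul_eq_zero.1 h2).resolve_left fun h0 => ?_
    rw [h0, nnnorm_zero] at hρz
    exact h.pos.not_ge hρz

theorem PowNearCompact.essSpectralRadius_le {T : B →L[ℂ] B} {ρ : ℝ≥0} (h : PowNearCompact T ρ) :
    essSpectralRadius T ≤ ρ :=
  inf_le_right.trans (iInf₂_le ρ h.splitsAt)

/-- For `r(S) < a < ρ`, the words with at most one `T` have total norm `O(n a ^ n)`, which is
eventually below `ρ ^ n`. -/
theorem powNearCompact_add {S T : B →L[ℂ] B} (h : ∀ k : ℕ, IsCompactOperator (T * S ^ k * T : B →L[ℂ] B))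
    {ρ : ℝ≥0} (hρ : spectralRadius ℂ S < ρ) : PowNearCompact (S + T) ρ := by
  obtain ⟨a, ha1, ha2⟩ := ENNReal.lt_iff_exists_nnreal_btwn.1 hρ
  have haρ : (a : ℝ) < ρ := by exact_mod_cast ha2
  have ha0 : (0 : ℝ) < a := by exact_mod_cast (zero_le (a := spectralRadius ℂ S)).trans_lt ha1
  have hρ0 : (0 : ℝ) < ρ := ha0.trans haρ
  obtain ⟨C, hC0, hC⟩ := exists_norm_pow_le ha1
  have hlt : (a : ℝ) / ρ < 1 := (div_lt_one hρ0).2 haρ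
  have hlim : Tendsto (fun n : ℕ => C * ((a : ℝ) / ρ) ^ n +
      C * ‖T‖ * C / a * (n * ((a : ℝ) / ρ) ^ n)) atTop (𝓝 (C * 0 + C * ‖T‖ * C / a * 0)) :=
    ((tendsto_pow_atTop_nhds_zero_of_lt_one (by positivity) hlt).const_mul _).add
      ((tendsto_self_mul_const_pow_of_lt_one (by positivity) hlt).const_mul _)
  rw [mul_zero, mul_zero, add_zero] at hlim
  obtain ⟨n, hn, hn1⟩ :=
    ((hlim.eventually_lt_const one_pos).and (eventually_ge_atTop 1)).exists
  obtain ⟨K, hK, hST⟩ := exists_compact_add_pow h n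
  refine ⟨n, hn1, K, hK, ?_⟩
  rw [hST, add_sub_cancel_right]
  calc _ ≤ ‖S ^ n‖ + ∑ i ∈ Finset.range n, ‖S ^ i * T * S ^ (n - 1 - i)‖ :=
        (norm_add_le _ _).trans (add_le_add le_rfl (norm_sum_le _ _))
    _ ≤ C * (a : ℝ) ^ n + ∑ i ∈ Finset.range n, C * ‖T‖ * C / a * (a : ℝ) ^ n := by
        refine add_le_add (hC n) (Finset.sum_le_sum fun i hi => ?_)
        calc _ ≤ ‖S ^ i‖ * ‖T‖ * ‖S ^ (n - 1 - i)‖ :=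
              (norm_mul_le _ _).trans (by gcongr; exact norm_mul_le _ _)
          _ ≤ (C * (a : ℝ) ^ i) * ‖T‖ * (C * (a : ℝ) ^ (n - 1 - i)) := by
              gcongr
              · exact hC _
              · exact hC _
          _ = C * ‖T‖ * C / a * (a : ℝ) ^ n := by
              have hin := Finset.mem_range.1 hi
              have : (a : ℝ) ^ n = (a : ℝ) ^ i * (a : ℝ) ^ (n - 1 - i) * a := by
                rw [← pow_add, ← pow_succ]; congr 1; omega
              rw [this]
              field_simp
    _ = (C * ((a : ℝ) / ρ) ^ n + C * ‖T‖ * C / a * (n * ((a : ℝ) / ρ) ^ n)) * (ρ : ℝ) ^ n := by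
        rw [Finset.sum_const, Finset.card_range, nsmul_eq_mul, div_pow]
        field_simp
    _ < 1 * (ρ : ℝ) ^ n := by gcongr
    _ = _ := one_mul _

end EssentialRadius

/-! ### Extended-norm estimates and completeness of the weighted space -/

section WeightedSpace

variable {E : Type*} [MeasurableSpace E] {w : Weight E}

theorem Bw.enorm_apply_le (f : Bw w) (x : E) : ‖f x‖ₑ ≤ ‖f‖ₑ * w x := by
  rw [← ofReal_norm, ← ofReal_norm, ← ENNReal.ofReal_coe_nnreal,
    ← ENNReal.ofReal_mul (norm_nonneg f)]
  exact ENNReal.ofReal_le_ofReal (f.apply_le x)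

theorem Bw.enorm_le {f : Bw w} {C : ℝ≥0∞} (h : ∀ x, ‖f x‖ₑ ≤ C * w x) : ‖f‖ₑ ≤ C := by
  rcases eq_or_ne C ∞ with rfl | hC
  · exact le_top
  lift C to ℝ≥0 using hC
  rw [← ofReal_norm, ← ENNReal.ofReal_coe_nnreal]
  refine ENNReal.ofReal_le_ofReal (Bw.norm_le C.2 fun x => ?_)
  have h1 := h x
  rw [← ENNReal.coe_mul, ← ofReal_norm, ← ENNReal.ofReal_coe_nnreal] at h1
  exact (ENNReal.ofReal_le_ofReal_iff (by positivity)).1 h1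

theorem Bw.opENorm_le {T : Bw w →L[ℂ] Bw w} {C : ℝ≥0∞}
    (h : ∀ f x, ‖T f x‖ₑ ≤ C * ‖f‖ₑ * w x) : ‖T‖ₑ ≤ C := by
  rcases eq_or_ne C ∞ with rfl | hC
  · exact le_top
  lift C to ℝ≥0 using hC
  have h1 : ∀ f, ‖T f‖ ≤ C * ‖f‖ := fun f => by
    have := Bw.enorm_le (h f)
    rw [← ofReal_norm, ← ofReal_norm, ← ENNReal.ofReal_coe_nnreal,
      ← ENNReal.ofReal_mul C.coe_nonneg] at this
    exact (ENNReal.ofReal_le_ofReal_iff (by positivity)).1 this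
  rw [← ofReal_norm, ← ENNReal.ofReal_coe_nnreal]
  exact ENNReal.ofReal_le_ofReal (T.opNorm_le_bound C.2 h1)

/-- Evaluation at a point. -/
noncomputable def Bw.eval (x : E) : Bw w →L[ℂ] ℂ :=
  LinearMap.mkContinuous
    { toFun := fun f => f x
      map_add' := fun _ _ => rfl
      map_smul' := fun _ _ => rfl } (w x) fun f => by
      rw [mul_comm]; exact f.apply_le x

instance : CompleteSpace (Bw w) := by
  refine Metric.complete_of_cauchySeq_tendsto fun u hu => ?_
  have hpt : ∀ x, ∃ z, Tendsto (fun n => u n x) atTop (𝓝 z) := fun x =>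
    cauchySeq_tendsto_of_complete ((Bw.eval x).uniformContinuous.comp_cauchySeq hu)
  choose g hg using hpt
  have hbd : ∀ ε > 0, ∃ N, ∀ n ≥ N, ∀ x, ‖u n x - g x‖ ≤ ε * w x := by
    intro ε hε
    obtain ⟨N, hN⟩ := Metric.cauchySeq_iff.1 hu ε hε
    refine ⟨N, fun n hn x => ?_⟩
    refine le_of_tendsto ((tendsto_const_nhds.sub (hg x)).norm) ?_
    filter_upwards [eventually_ge_atTop N] with m hm
    have := (u n - u m).apply_le x
    refine le_trans this (mul_le_mul_of_nonneg_right ?_ (w.pos x).le)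
    rw [← dist_eq_norm]
    exact (hN n hn m hm).le
  have hgm : Measurable g :=
    measurable_of_tendsto_metrizable (fun n => (u n).measurable) (tendsto_pi_nhds.2 hg)
  obtain ⟨N, hN⟩ := hbd 1 one_pos
  let G : Bw w := ⟨g, hgm, ‖u N‖ + 1, fun x => (div_le_iff₀ (w.pos x)).2 (by
    have h1 := hN N le_rfl x
    have h2 := (u N).apply_le x
    have h3 := norm_sub_norm_le (g x) (u N x)
    rw [norm_sub_rev] at h3
    rw [add_mul]
    linarith)⟩
  refine ⟨G, Metric.tendsto_atTop.2 fun ε hε => ?_⟩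
  obtain ⟨N, hN⟩ := hbd (ε / 2) (by positivity)
  refine ⟨N, fun n hn => ?_⟩
  rw [dist_eq_norm]
  exact (Bw.norm_le (by positivity) fun x => hN n hn x).trans_lt (by linarith)

theorem Weight.coe_ne_zero (w : Weight E) (x : E) : (w x : ℝ≥0∞) ≠ 0 := by
  have := w.one_le' x
  exact_mod_cast (one_pos.trans_le this).ne'

theorem Weight.measurable_coe (w : Weight E) : Measurable fun x => (w x : ℝ≥0∞) :=
  w.measurable'.coe_nnreal_ennreal

/-- The weight as an element of the weighted space. -/
noncomputable def Weight.toBw (w : Weight E) : Bw w :=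
  ⟨fun x => ((w x : ℝ) : ℂ), Complex.measurable_ofReal.comp w.measurable'.coe_nnreal_real, 1,
    fun x => by
      rw [Complex.norm_real, Real.norm_of_nonneg (w.pos x).le, div_self (w.pos x).ne']⟩

theorem Weight.toBw_apply (w : Weight E) (x : E) : w.toBw x = ((w x : ℝ) : ℂ) := rfl

theorem Weight.enorm_toBw_le (w : Weight E) : ‖w.toBw‖ₑ ≤ 1 :=
  Bw.enorm_le fun x => by
    rw [Weight.toBw_apply, ← ofReal_norm, Complex.norm_real, Real.norm_of_nonneg (w.pos x).le,
      ENNReal.ofReal_coe_nnreal, one_mul]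

end WeightedSpace

/-! ### Powers of kernels and domination of twisted operators -/

section Powers

variable {E : Type*} [MeasurableSpace E] {w : Weight E} {κ : Kernel E E}

theorem ActsOn.integrable (h : ActsOn w κ) (f : Bw w) (x : E) : Integrable f (κ x) := by
  obtain ⟨C, hC⟩ := h
  exact (integral_bound (hC x) f.measurable (norm_nonneg f) f.apply_le).1

theorem ActsOn.integrable_mul (h : ActsOn w κ) (χ : Multiplier E) (f : Bw w) (x : E) :
    Integrable (fun y => f y * χ (x, y)) (κ x) := by
  obtain ⟨C, hC⟩ := h
  obtain ⟨M, hM⟩ := χ.bounded'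
  have b := twisted_bound hM f x
  exact (integral_bound (hC x) b.1 b.2.1 b.2.2).1

instance isFiniteKernel_pow [IsFiniteKernel κ] (n : ℕ) : IsFiniteKernel (κ ^ n) := by
  induction n with
  | zero =>
    rw [pow_zero]
    exact inferInstanceAs (IsFiniteKernel (Kernel.id : Kernel E E))
  | succ n ih =>
    rw [pow_succ]
    exact inferInstanceAs (IsFiniteKernel ((κ ^ n) ∘ₖ κ))

theorem lintegral_pow_succ (n : ℕ) (x : E) {g : E → ℝ≥0∞} (hg : Measurable g) :
    ∫⁻ z, g z ∂(κ ^ (n + 1)) x = ∫⁻ y, ∫⁻ z, g z ∂(κ ^ n) y ∂κ x := by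
  rw [pow_succ]
  exact Kernel.lintegral_comp (κ ^ n) κ x hg

theorem kernelOp_pow_apply (h : ActsOn w κ) (n : ℕ) (f : Bw w) (x : E) :
    ((kernelOp h) ^ n) f x = ∫ y, f y ∂(κ ^ n) x := by
  induction n generalizing x with
  | zero =>
    rw [pow_zero, pow_zero]
    change f x = ∫ y, f y ∂(Kernel.id : Kernel E E) x
    rw [Kernel.id_apply, integral_dirac' _ _ f.measurable.stronglyMeasurable]
  | succ n ih =>
    have hint := (h.pow (n + 1)).integrable f x
    rw [pow_succ']
    rw [mul_apply_eq_comp, kernelOp_apply]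
    simp only [ih]
    rw [pow_succ] at hint ⊢
    exact (Kernel.integral_comp hint).symm

theorem kernelOp_pow (h : ActsOn w κ) (n : ℕ) : (kernelOp h) ^ n = kernelOp (h.pow n) := by
  ext1 f
  exact Bw.ext fun x => by rw [kernelOp_pow_apply, kernelOp_apply]

/-- The weight itself lies in the unit ball and the kernel is positive, so the integral is a value
of the operator at `w`. -/
theorem lintegral_weight_pow_le (h : ActsOn w κ) (n : ℕ) (x : E) :
    ∫⁻ y, (w y : ℝ≥0∞) ∂(κ ^ n) x ≤ ‖(kernelOp h) ^ n‖ₑ * w x := by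
  have h1 : ∫⁻ y, (w y : ℝ≥0∞) ∂(κ ^ n) x = ‖((kernelOp h) ^ n) w.toBw x‖ₑ := by
    have hint : Integrable (fun y => (w y : ℝ)) ((κ ^ n) x) := by
      have := ((h.pow n).integrable w.toBw x).re
      simpa [Weight.toBw_apply] using this
    rw [kernelOp_pow_apply]
    simp only [Weight.toBw_apply]
    rw [integral_complex_ofReal, ← ofReal_norm, Complex.norm_real,
      Real.norm_of_nonneg (integral_nonneg fun y => (w.pos y).le),
      ofReal_integral_eq_lintegral_ofReal hint (Eventually.of_forall fun y => (w.pos y).le)]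
    simp
  rw [h1]
  calc _ ≤ ‖((kernelOp h) ^ n) w.toBw‖ₑ * w x := Bw.enorm_apply_le _ x
    _ ≤ ‖(kernelOp h) ^ n‖ₑ * ‖w.toBw‖ₑ * w x := by
        gcongr; exact ((kernelOp h) ^ n).le_opENorm _
    _ ≤ ‖(kernelOp h) ^ n‖ₑ * 1 * w x := by gcongr; exact w.enorm_toBw_le
    _ = _ := by rw [mul_one]

theorem enorm_twistedOp_le [IsFiniteKernel κ] (h : ActsOn w κ) {ξ : Multiplier E} {c : ℝ≥0∞}
    (hξ : ∀ p, ‖ξ p‖ₑ ≤ c) (f : Bw w) (x : E) :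
    ‖twistedOp h ξ f x‖ₑ ≤ c * ∫⁻ y, ‖f y‖ₑ ∂κ x := by
  rw [twistedOp_apply]
  calc _ ≤ ∫⁻ y, ‖f y * ξ (x, y)‖ₑ ∂κ x := enorm_integral_le_lintegral_enorm _
    _ ≤ ∫⁻ y, c * ‖f y‖ₑ ∂κ x := lintegral_mono fun y => by
        rw [enorm_mul, mul_comm]; gcongr; exact hξ _
    _ = _ := lintegral_const_mul _ f.measurable.enorm

theorem enorm_twistedOp_pow_le [IsFiniteKernel κ] (h : ActsOn w κ) {ξ : Multiplier E} {c : ℝ≥0∞}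
    (hξ : ∀ p, ‖ξ p‖ₑ ≤ c) (n : ℕ) (f : Bw w) (x : E) :
    ‖((twistedOp h ξ) ^ n) f x‖ₑ ≤ c ^ n * ∫⁻ y, ‖f y‖ₑ ∂(κ ^ n) x := by
  induction n generalizing x with
  | zero =>
    rw [pow_zero, pow_zero, pow_zero, one_mul]
    change ‖f x‖ₑ ≤ ∫⁻ y, ‖f y‖ₑ ∂(Kernel.id : Kernel E E) x
    rw [Kernel.id_apply, lintegral_dirac' _ f.measurable.enorm]
  | succ n ih =>
    rw [pow_succ' (twistedOp h ξ), mul_apply_eq_comp, lintegral_pow_succ n x f.measurable.enorm]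
    calc _ ≤ c * ∫⁻ y, ‖((twistedOp h ξ) ^ n) f y‖ₑ ∂κ x := enorm_twistedOp_le h hξ _ x
      _ ≤ c * ∫⁻ y, c ^ n * ∫⁻ z, ‖f z‖ₑ ∂(κ ^ n) y ∂κ x := by
          gcongr with y; exact ih y
      _ = _ := by
          rw [lintegral_const_mul _ (Measurable.lintegral_kernel f.measurable.enorm), ← mul_assoc,
            pow_succ']

theorem enorm_twistedOp_pow [IsFiniteKernel κ] (h : ActsOn w κ) {ξ : Multiplier E} {c : ℝ≥0∞}
    (hξ : ∀ p, ‖ξ p‖ₑ ≤ c) (n : ℕ) :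
    ‖(twistedOp h ξ) ^ n‖ₑ ≤ c ^ n * ‖(kernelOp h) ^ n‖ₑ := by
  refine Bw.opENorm_le fun f x => (enorm_twistedOp_pow_le h hξ n f x).trans ?_
  calc _ ≤ c ^ n * ∫⁻ y, ‖f‖ₑ * w y ∂(κ ^ n) x := by
        gcongr with y; exact f.enorm_apply_le y
    _ = c ^ n * (‖f‖ₑ * ∫⁻ y, w y ∂(κ ^ n) x) := by
        rw [lintegral_const_mul _ w.measurable_coe]
    _ ≤ c ^ n * (‖f‖ₑ * (‖(kernelOp h) ^ n‖ₑ * w x)) := by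
        gcongr; exact lintegral_weight_pow_le h n x
    _ = _ := by ring

/-- Pointwise domination by the positive kernel bounds the `n`-th power by `c ^ n` times that of the
untwisted operator; then Gelfand's formula applies. -/
theorem spectralRadius_twistedOp_le [IsFiniteKernel κ] (h : ActsOn w κ) {ξ : Multiplier E}
    {c : ℝ≥0∞} (hc : c ≠ ∞) (hξ : ∀ p, ‖ξ p‖ₑ ≤ c) :
    spectralRadius ℂ (twistedOp h ξ) ≤ c * spectralRadius ℂ (kernelOp h) := by
  refine le_of_tendsto_of_tendsto
    (spectrum.pow_nnnorm_pow_one_div_tendsto_nhds_spectralRadius (twistedOp h ξ))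
    (ENNReal.Tendsto.const_mul
      (spectrum.pow_nnnorm_pow_one_div_tendsto_nhds_spectralRadius (kernelOp h)) (Or.inr hc)) ?_
  filter_upwards [eventually_gt_atTop 0] with n hn
  have hn' : (n : ℝ) ≠ 0 := by positivity
  calc _ ≤ (c ^ n * (‖(kernelOp h) ^ n‖₊ : ℝ≥0∞)) ^ (1 / n : ℝ) :=
        ENNReal.rpow_le_rpow (enorm_twistedOp_pow h hξ n) (by positivity)
    _ = _ := by
        rw [ENNReal.mul_rpow_of_nonneg _ _ (by positivity), ← ENNReal.rpow_natCast,
          ← ENNReal.rpow_mul, mul_one_div_cancel hn', ENNReal.rpow_one]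

end Powers

/-! ### Density in L¹ of sums of separated functions -/

section Separated

variable {E : Type*} [MeasurableSpace E]

/-- The functions `(x, y) ↦ a x * b y` with `a`, `b` bounded and measurable. -/
def separated (E : Type*) [MeasurableSpace E] : Submonoid (E × E → ℂ) where
  carrier := {g | ∃ a b : E → ℂ, Measurable a ∧ Measurable b ∧ (∃ C : ℝ≥0, ∀ x, ‖a x‖₊ ≤ C) ∧
    (∃ C : ℝ≥0, ∀ x, ‖b x‖₊ ≤ C) ∧ g = fun p => a p.1 * b p.2}
  one_mem' := ⟨1, 1, measurable_const, measurable_const, ⟨1, by simp⟩, ⟨1, by simp⟩, by ext; simp⟩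
  mul_mem' := by
    rintro _ _ ⟨a, b, ha, hb, ⟨A, hA⟩, ⟨B, hB⟩, rfl⟩ ⟨a', b', ha', hb', ⟨A', hA'⟩, ⟨B', hB'⟩, rfl⟩
    refine ⟨a * a', b * b', ha.mul ha', hb.mul hb', ⟨A * A', fun x => ?_⟩, ⟨B * B', fun x => ?_⟩, ?_⟩
    · rw [Pi.mul_apply, nnnorm_mul]; exact mul_le_mul' (hA x) (hA' x)
    · rw [Pi.mul_apply, nnnorm_mul]; exact mul_le_mul' (hB x) (hB' x)
    · ext p; simp only [Pi.mul_apply]; ring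

/-- Separated functions are closed under products, so the algebra they generate is just their linear
span. -/
theorem adjoin_separated_induction {P : (E × E → ℂ) → Prop} (hzero : P 0)
    (hadd : ∀ f g, P f → P g → P (f + g)) (hsmul : ∀ (c : ℂ) f, P f → P (c • f))
    (hsep : ∀ g ∈ separated E, P g) {g : E × E → ℂ}
    (hg : g ∈ Algebra.adjoin ℂ (separated E : Set (E × E → ℂ))) : P g := by
  rw [← Subalgebra.mem_toSubmodule, Algebra.adjoin_eq_span, Submonoid.closure_eq] at hg
  induction hg using Submodule.span_induction with
  | mem x hx => exact hsep x hx
  | zero => exact hzero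
  | add x y _ _ hx hy => exact hadd x y hx hy
  | smul a x _ hx => exact hsmul a x hx

theorem measurable_and_bounded_of_mem_adjoin {g : E × E → ℂ}
    (hg : g ∈ Algebra.adjoin ℂ (separated E : Set (E × E → ℂ))) :
    Measurable g ∧ ∃ C : ℝ≥0, ∀ p, ‖g p‖₊ ≤ C := by
  refine adjoin_separated_induction (P := fun g => Measurable g ∧ ∃ C : ℝ≥0, ∀ p, ‖g p‖₊ ≤ C)
    ⟨measurable_const, 0, by simp⟩ ?_ ?_ ?_ hg
  · rintro f g ⟨hf, C, hC⟩ ⟨hg, D, hD⟩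
    exact ⟨hf.add hg, C + D, fun p => (nnnorm_add_le _ _).trans (add_le_add (hC p) (hD p))⟩
  · rintro c f ⟨hf, C, hC⟩
    refine ⟨hf.const_smul c, ‖c‖₊ * C, fun p => ?_⟩
    rw [Pi.smul_apply, nnnorm_smul]
    exact mul_le_mul' le_rfl (hC p)
  · rintro _ ⟨a, b, ha, hb, ⟨A, hA⟩, ⟨B, hB⟩, rfl⟩
    refine ⟨(ha.comp measurable_fst).mul (hb.comp measurable_snd), A * B, fun p => ?_⟩
    rw [nnnorm_mul]
    exact mul_le_mul' (hA _) (hB _)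

/-- The sets whose indicator is a linear combination of separated functions. -/
def separatedSets (E : Type*) [MeasurableSpace E] : Set (Set (E × E)) :=
  {s | MeasurableSet s ∧
    s.indicator (fun _ => (1 : ℂ)) ∈ Algebra.adjoin ℂ (separated E : Set (E × E → ℂ))}

theorem prod_mem_separatedSets {A B : Set E} (hA : MeasurableSet A) (hB : MeasurableSet B) :
    A ×ˢ B ∈ separatedSets E := by
  refine ⟨hA.prod hB, Algebra.subset_adjoin ⟨A.indicator fun _ => 1, B.indicator fun _ => 1,
    measurable_const.indicator hA, measurable_const.indicator hB, ⟨1, fun x => ?_⟩,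
    ⟨1, fun x => ?_⟩, ?_⟩⟩
  · by_cases h : x ∈ A <;> simp [h]
  · by_cases h : x ∈ B <;> simp [h]
  · ext ⟨x, y⟩
    by_cases hx : x ∈ A <;> by_cases hy : y ∈ B <;> simp [hx, hy]

/-- The algebra structure on functions turns complements and unions into `1 - f` and `f + g - f *
g`. This set algebra contains the rectangles and so is measure-dense for any finite measure. -/
theorem isSetAlgebra_separatedSets : IsSetAlgebra (separatedSets E) where
  empty_mem := ⟨MeasurableSet.empty, by
    rw [Set.indicator_empty]
    exact Subalgebra.zero_mem _⟩
  compl_mem := fun s hs => ⟨hs.1.compl, by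
    have : sᶜ.indicator (fun _ => (1 : ℂ)) = 1 - s.indicator fun _ => 1 := by
      ext p; by_cases h : p ∈ s <;> simp [h]
    rw [this]
    exact Subalgebra.sub_mem _ (Subalgebra.one_mem _) hs.2⟩
  union_mem := fun s t hs ht => ⟨hs.1.union ht.1, by
    have : (s ∪ t).indicator (fun _ => (1 : ℂ)) = s.indicator (fun _ => 1) +
        t.indicator (fun _ => 1) - s.indicator (fun _ => 1) * t.indicator (fun _ => 1) := by
      ext p; by_cases h : p ∈ s <;> by_cases h' : p ∈ t <;> simp [h, h']
    rw [this]
    exact Subalgebra.sub_mem _ (Subalgebra.add_mem _ hs.2 ht.2) (Subalgebra.mul_mem _ hs.2 ht.2)⟩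

theorem generateFrom_separatedSets :
    (inferInstance : MeasurableSpace (E × E)) = MeasurableSpace.generateFrom (separatedSets E) := by
  refine le_antisymm ?_ (MeasurableSpace.generateFrom_le fun s hs => hs.1)
  conv_lhs => rw [← generateFrom_prod]
  refine MeasurableSpace.generateFrom_mono ?_
  rintro _ ⟨A, hA, B, hB, rfl⟩
  exact prod_mem_separatedSets hA hB

theorem exists_separated_eLpNorm_sub_indicator_le {μ : Measure (E × E)} [IsFiniteMeasure μ] (c : ℂ)
    {s : Set (E × E)} (hs : MeasurableSet s) {ε : ℝ≥0∞} (hε : ε ≠ 0) :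
    ∃ h : E × E → ℂ, eLpNorm (h - s.indicator fun _ => c) 1 μ ≤ ε ∧
      h ∈ Algebra.adjoin ℂ (separated E : Set (E × E → ℂ)) := by
  have hdense := Measure.MeasureDense.of_generateFrom_isSetAlgebra_finite (μ := μ)
    isSetAlgebra_separatedSets generateFrom_separatedSets
  obtain ⟨δ, hδ, hδε⟩ : ∃ δ : ℝ, 0 < δ ∧ ‖c‖ₑ * ENNReal.ofReal δ ≤ ε := by
    rcases eq_or_ne ε ∞ with rfl | hεt
    · exact ⟨1, one_pos, le_top⟩
    · refine ⟨ε.toReal / (1 + ‖c‖), div_pos (ENNReal.toReal_pos hε hεt) (by positivity), ?_⟩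
      rw [← ofReal_norm, ← ENNReal.ofReal_mul (norm_nonneg c)]
      refine ENNReal.ofReal_le_of_le_toReal ?_
      rw [mul_div_assoc', div_le_iff₀ (by positivity)]
      nlinarith [ENNReal.toReal_nonneg (a := ε), norm_nonneg c]
  obtain ⟨t, ht, hst⟩ := hdense.approx s hs (measure_ne_top μ s) δ hδ
  refine ⟨c • t.indicator fun _ => 1, ?_, Subalgebra.smul_mem _ ht.2 c⟩
  have heq : ∀ p, ‖((c • t.indicator fun _ => (1 : ℂ)) - s.indicator fun _ => c) p‖ₑ =
      (symmDiff s t).indicator (fun _ => ‖c‖ₑ) p := by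
    intro p
    by_cases h : p ∈ s <;> by_cases h' : p ∈ t <;> simp [h, h', Set.mem_symmDiff]
  rw [eLpNorm_one_eq_lintegral_enorm, lintegral_congr heq,
    lintegral_indicator_const (hs.symmDiff ht.1)]
  exact le_trans (by gcongr) hδε

theorem exists_separated_eLpNorm_sub_le {μ : Measure (E × E)} [IsFiniteMeasure μ] {g : E × E → ℂ}
    (hg : MemLp g 1 μ) {ε : ℝ≥0∞} (hε : ε ≠ 0) :
    ∃ h ∈ Algebra.adjoin ℂ (separated E : Set (E × E → ℂ)), eLpNorm (g - h) 1 μ ≤ ε := by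
  obtain ⟨h, h1, h2⟩ := hg.induction_dense ENNReal.one_ne_top
    (fun h => h ∈ Algebra.adjoin ℂ (separated E : Set (E × E → ℂ)))
    (fun c s hs _ ε hε => exists_separated_eLpNorm_sub_indicator_le c hs hε)
    (fun f g => Subalgebra.add_mem _)
    (fun f hf => (measurable_and_bounded_of_mem_adjoin hf).1.aestronglyMeasurable) hε
  exact ⟨h, h2, h1⟩

end Separated

/-! ### Operators given by a density with respect to `ν` -/

section Density

variable {E : Type*} [MeasurableSpace E] {w : Weight E}

theorem lintegral_enorm_mul_le {ν : Measure E} {g : E → ℂ} (f : Bw w) :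
    ∫⁻ y, ‖f y * g y‖ₑ ∂ν ≤ ‖f‖ₑ * ∫⁻ y, ‖g y‖ₑ * w y ∂ν := by
  rw [← lintegral_const_mul' _ _ enorm_ne_top]
  refine lintegral_mono fun y => ?_
  rw [enorm_mul, mul_comm ‖g y‖ₑ, ← mul_assoc]
  gcongr
  exact f.enorm_apply_le y

theorem integrable_mul_of_lintegral_lt_top {ν : Measure E} {g : E → ℂ} (hg : Measurable g)
    (h : ∫⁻ y, ‖g y‖ₑ * w y ∂ν < ∞) (f : Bw w) : Integrable (fun y => f y * g y) ν :=
  ⟨(f.measurable.mul hg).aestronglyMeasurable,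
    (lintegral_enorm_mul_le f).trans_lt (ENNReal.mul_lt_top enorm_lt_top h)⟩

theorem exists_densityOp (ν : Measure E) [SFinite ν] {g : E × E → ℂ} (hg : Measurable g) {C : ℝ≥0}
    (hC : ∀ x, ∫⁻ y, ‖g (x, y)‖ₑ * w y ∂ν ≤ C * w x) :
    ∃ T : Bw w →L[ℂ] Bw w, ∀ f x, T f x = ∫ y, f y * g (x, y) ∂ν := by
  have hgx : ∀ x, Measurable fun y => g (x, y) := fun x => hg.comp measurable_prodMk_left
  have hfin : ∀ x, ∫⁻ y, ‖g (x, y)‖ₑ * w y ∂ν < ∞ := fun x =>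
    (hC x).trans_lt (by rw [← ENNReal.coe_mul]; exact ENNReal.coe_lt_top)
  have hb : ∀ (f : Bw w) x, ‖∫ y, f y * g (x, y) ∂ν‖ ≤ ‖f‖ * C * w x := fun f x => by
    rw [← ENNReal.ofReal_le_ofReal_iff (by positivity), ofReal_norm, mul_assoc,
      ENNReal.ofReal_mul (norm_nonneg f), ofReal_norm, ← NNReal.coe_mul, ENNReal.ofReal_coe_nnreal,
      ENNReal.coe_mul]
    refine (enorm_integral_le_lintegral_enorm _).trans ((lintegral_enorm_mul_le f).trans ?_)
    gcongr
    exact hC x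
  refine ⟨LinearMap.mkContinuous
    { toFun := fun f => ⟨fun x => ∫ y, f y * g (x, y) ∂ν,
        (StronglyMeasurable.integral_prod_right' (f := fun p : E × E => f p.2 * g p)
          ((f.measurable.comp measurable_snd).mul hg).stronglyMeasurable).measurable, ‖f‖ * C,
        fun x => (div_le_iff₀ (w.pos x)).2 (hb f x)⟩
      map_add' := fun f f' => Bw.ext fun x => ?_
      map_smul' := fun c f => Bw.ext fun x => ?_ } C fun f => ?_, fun f x => rfl⟩
  · change ∫ y, (f y + f' y) * g (x, y) ∂ν = _
    simp only [add_mul]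
    exact integral_add (integrable_mul_of_lintegral_lt_top (hgx x) (hfin x) f)
      (integrable_mul_of_lintegral_lt_top (hgx x) (hfin x) f')
  · change ∫ y, (c * f y) * g (x, y) ∂ν = _
    simp only [mul_assoc]
    exact integral_const_mul c _
  · refine Bw.norm_le (by positivity) fun x => ?_
    rw [mul_comm (C : ℝ)]
    exact hb f x

/-- The operator has rank at most one. The functional `c` is not assumed continuous: when the
operator is nonzero it is replaced by evaluation of `T f` at a point. -/
theorem isCompactOperator_of_apply_eq_mul {T : Bw w →L[ℂ] Bw w} {a : E → ℂ} {c : Bw w → ℂ}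
    (h : ∀ f x, T f x = a x * c f) : IsCompactOperator T := by
  by_cases h0 : ∀ f x, T f x = 0
  · have : T = 0 := by ext1 f; exact Bw.ext (h0 f)
    rw [this]
    exact isCompactOperator_zero
  · push Not at h0
    obtain ⟨f₀, x₀, h0⟩ := h0
    have hT : T = (ContinuousLinearMap.toSpanSingleton ℂ ((T f₀ x₀)⁻¹ • T f₀)) ∘L
        ((Bw.eval x₀) ∘L T) := by
      ext1 f
      refine Bw.ext fun x => ?_
      change T f x = T f x₀ * ((T f₀ x₀)⁻¹ * T f₀ x)
      rw [h] at h0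
      rw [h, h, h, h]
      have h1 := left_ne_zero_of_mul h0
      have h2 := right_ne_zero_of_mul h0
      field_simp
    rw [hT]
    exact (isCompactOperator_of_locallyCompactSpace_dom ((Bw.eval x₀) ∘L T)).clm_comp
      (ContinuousLinearMap.toSpanSingleton ℂ ((T f₀ x₀)⁻¹ • T f₀))

theorem enorm_conj_weight_mul_le (w : Weight E) {h : ℂ} {M : ℝ≥0∞} (hM : ‖h‖ₑ ≤ M) (x y : E) :
    ‖((w x : ℝ) : ℂ) * h * ((w y : ℝ) : ℂ)⁻¹‖ₑ * w y ≤ M * w x := by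
  have e : ∀ z, ‖((w z : ℝ) : ℂ)‖ₑ = w z := fun z => by
    rw [← ofReal_norm, Complex.norm_real, Real.norm_of_nonneg (w.pos z).le,
      ENNReal.ofReal_coe_nnreal]
  rw [enorm_mul, enorm_mul, enorm_inv (by exact_mod_cast (w.pos y).ne'), e, e, mul_assoc,
    ENNReal.inv_mul_cancel (w.coe_ne_zero y) ENNReal.coe_ne_top, mul_one, mul_comm]
  gcongr

theorem exists_compact_densityOp_of_separated (w : Weight E) (ν : Measure E) [IsProbabilityMeasure ν]
    {h : E × E → ℂ} (hh : h ∈ Algebra.adjoin ℂ (separated E : Set (E × E → ℂ))) :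
    ∃ T : Bw w →L[ℂ] Bw w, IsCompactOperator T ∧ ∀ f x,
      T f x = ∫ y, f y * (((w x : ℝ) : ℂ) * h (x, y) * ((w y : ℝ) : ℂ)⁻¹) ∂ν := by
  have hwm : Measurable fun x => ((w x : ℝ) : ℂ) :=
    Complex.measurable_ofReal.comp w.measurable'.coe_nnreal_real
  have hbound : ∀ {h : E × E → ℂ} {C : ℝ≥0}, (∀ p, ‖h p‖₊ ≤ C) → ∀ x,
      ∫⁻ y, ‖((w x : ℝ) : ℂ) * h (x, y) * ((w y : ℝ) : ℂ)⁻¹‖ₑ * w y ∂ν ≤ C * w x := by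
    intro h C hC x
    calc _ ≤ ∫⁻ _, (C : ℝ≥0∞) * w x ∂ν := lintegral_mono fun y =>
          enorm_conj_weight_mul_le w (ENNReal.coe_le_coe.2 (hC (x, y))) x y
      _ = _ := by simp
  have hint : ∀ {h : E × E → ℂ}, (Measurable h ∧ ∃ C : ℝ≥0, ∀ p, ‖h p‖₊ ≤ C) → ∀ (f : Bw w) x,
      Integrable (fun y => f y * (((w x : ℝ) : ℂ) * h (x, y) * ((w y : ℝ) : ℂ)⁻¹)) ν := by
    rintro h ⟨hm, C, hC⟩ f x
    refine integrable_mul_of_lintegral_lt_top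
      (((hm.comp measurable_prodMk_left).const_mul _).mul hwm.inv)
      ((hbound hC x).trans_lt ?_) f
    rw [← ENNReal.coe_mul]
    exact ENNReal.coe_lt_top
  suffices H : (Measurable h ∧ ∃ C : ℝ≥0, ∀ p, ‖h p‖₊ ≤ C) ∧
      ∃ T : Bw w →L[ℂ] Bw w, IsCompactOperator T ∧ ∀ f x,
        T f x = ∫ y, f y * (((w x : ℝ) : ℂ) * h (x, y) * ((w y : ℝ) : ℂ)⁻¹) ∂ν from H.2
  refine adjoin_separated_induction (P := fun h => (Measurable h ∧ ∃ C : ℝ≥0, ∀ p, ‖h p‖₊ ≤ C) ∧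
      ∃ T : Bw w →L[ℂ] Bw w, IsCompactOperator T ∧ ∀ f x,
        T f x = ∫ y, f y * (((w x : ℝ) : ℂ) * h (x, y) * ((w y : ℝ) : ℂ)⁻¹) ∂ν) ?_ ?_ ?_ ?_ hh
  · exact ⟨⟨measurable_const, 0, by simp⟩, 0, isCompactOperator_zero, fun f x => by simp⟩
  · rintro f g ⟨⟨hf, C, hC⟩, T, hT, hTf⟩ ⟨⟨hg, D, hD⟩, T', hT', hTg⟩
    refine ⟨⟨hf.add hg, C + D,
      fun p => (nnnorm_add_le _ _).trans (add_le_add (hC p) (hD p))⟩, T + T', hT.add hT',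
      fun u x => ?_⟩
    rw [add_apply, Bw.add_apply, hTf, hTg, ← integral_add (hint ⟨hf, C, hC⟩ u x)
      (hint ⟨hg, D, hD⟩ u x)]
    congr 1
    ext y
    simp only [Pi.add_apply]
    ring
  · rintro c f ⟨⟨hf, C, hC⟩, T, hT, hTf⟩
    refine ⟨⟨hf.const_smul c, ‖c‖₊ * C, fun p => ?_⟩, c • T, hT.smul c, fun u x => ?_⟩
    · rw [Pi.smul_apply, nnnorm_smul]
      exact mul_le_mul' le_rfl (hC p)
    · rw [smul_apply, Bw.smul_apply, hTf, ← integral_const_mul]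
      congr 1
      ext y
      simp only [Pi.smul_apply, smul_eq_mul]
      ring
  · intro g hg
    have hmb := measurable_and_bounded_of_mem_adjoin (Algebra.subset_adjoin hg)
    obtain ⟨hgm, C, hC⟩ := hmb
    obtain ⟨a, b, ha, hb, -, -, hgab⟩ := hg
    obtain ⟨T, hT⟩ := exists_densityOp (w := w) ν
      (g := fun p => ((w p.1 : ℝ) : ℂ) * g p * ((w p.2 : ℝ) : ℂ)⁻¹)
      (((hwm.comp measurable_fst).mul hgm).mul (hwm.comp measurable_snd).inv) (hbound hC)
    refine ⟨⟨hgm, C, hC⟩, T, isCompactOperator_of_apply_eq_mul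
      (a := fun x => ((w x : ℝ) : ℂ) * a x)
      (c := fun f => ∫ y, f y * (b y * ((w y : ℝ) : ℂ)⁻¹) ∂ν) fun f x => ?_, hT⟩
    rw [hT, ← integral_const_mul]
    congr 1
    ext y
    rw [hgab]
    ring

end Density

/-! ### Compactness of `T V T` -/

section Compactness

variable {E : Type*} [MeasurableSpace E] {w : Weight E}

/-- The kernel `w(y)⁻¹ κ(y, dz) w(z)`. -/
noncomputable def weightedKernel (w : Weight E) (κ : Kernel E E) [IsSFiniteKernel κ] : Kernel E E :=
  κ.withDensity fun y z => (w y : ℝ≥0∞)⁻¹ * w z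

theorem lintegral_weightedKernel (κ : Kernel E E) [IsSFiniteKernel κ] (y : E) {D : E → ℝ≥0∞}
    (hD : Measurable D) :
    ∫⁻ z, D z ∂(weightedKernel w κ) y = (w y : ℝ≥0∞)⁻¹ * ∫⁻ z, w z * D z ∂κ y := by
  rw [weightedKernel, Kernel.lintegral_withDensity _ (((w.measurable_coe.comp measurable_fst).inv).mul
      (w.measurable_coe.comp measurable_snd)) _ hD]
  simp only [mul_assoc]
  exact lintegral_const_mul _ (w.measurable_coe.mul hD)

theorem isFiniteKernel_weightedKernel {κ : Kernel E E} [IsSFiniteKernel κ] (h : ActsOn w κ) :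
    IsFiniteKernel (weightedKernel w κ) := by
  obtain ⟨C, hC⟩ := h
  refine ⟨⟨C, ENNReal.coe_lt_top, fun y => ?_⟩⟩
  rw [← lintegral_one, lintegral_weightedKernel κ y measurable_const]
  simp only [mul_one]
  rw [mul_comm, ← div_eq_mul_inv]
  exact ENNReal.div_le_of_le_mul (hC y)

/-- With `h = w⁻¹ g w` bounded by `M` and `T₀` given by another density `h₀` in the same way, `‖T V
(T - T₀)‖` is at most `M * c` times the L¹ distance of `h` and `h₀` for `μ.prod ν`. Taking `h₀` in
the span of separated functions makes `T₀` compact, and compact operators are closed. -/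
theorem isCompactOperator_density_comp (ν : Measure E) [IsProbabilityMeasure ν] {g : E × E → ℂ}
    (hg : Measurable g) {M : ℝ≥0} (hM : ∀ x y, ‖g (x, y)‖ₑ * w y ≤ M * w x)
    {T V : Bw w →L[ℂ] Bw w} (hT : ∀ f x, T f x = ∫ y, f y * g (x, y) ∂ν)
    {κ : Kernel E E} [IsSFiniteKernel κ] (hκ : ActsOn w κ) {c : ℝ≥0}
    (hV : ∀ f x, ‖V f x‖ₑ ≤ c * ∫⁻ y, ‖f y‖ₑ ∂κ x) :
    IsCompactOperator (T * V * T : Bw w →L[ℂ] Bw w) := by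
  have := isFiniteKernel_weightedKernel hκ
  have hwm : Measurable fun x => ((w x : ℝ) : ℂ) :=
    Complex.measurable_ofReal.comp w.measurable'.coe_nnreal_real
  have hw0 : ∀ x, ((w x : ℝ) : ℂ) ≠ 0 := fun x => by exact_mod_cast (w.pos x).ne'
  have hwe : ∀ z, ‖((w z : ℝ) : ℂ)‖ₑ = w z := fun z => by
    rw [← ofReal_norm, Complex.norm_real, Real.norm_of_nonneg (w.pos z).le,
      ENNReal.ofReal_coe_nnreal]
  -- The law of the intermediate point: the left `T` integrates against `ν` and `V` moves this by
  -- `κ`, in weighted form.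
  set μ := ν.bind (weightedKernel w κ) with hμ
  obtain ⟨h, hh⟩ : ∃ h : E × E → ℂ, h = fun p => ((w p.1 : ℝ) : ℂ)⁻¹ * g p * ((w p.2 : ℝ) : ℂ) :=
    ⟨_, rfl⟩
  have hhm : Measurable h := by
    rw [hh]
    exact ((hwm.comp measurable_fst).inv.mul hg).mul (hwm.comp measurable_snd)
  have hhM : ∀ p, ‖h p‖ₑ ≤ M := fun p => by
    rw [hh]
    simp only
    rw [mul_assoc, enorm_mul, enorm_mul, enorm_inv (hw0 _), hwe, hwe, mul_comm, ← div_eq_mul_inv]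
    exact ENNReal.div_le_of_le_mul (hM _ _)
  have hgh : ∀ x y, g (x, y) = ((w x : ℝ) : ℂ) * h (x, y) * ((w y : ℝ) : ℂ)⁻¹ := fun x y => by
    rw [hh]
    have := hw0 x
    have := hw0 y
    field_simp
  have hL1 : MemLp h 1 (μ.prod ν) := by
    refine MemLp.of_bound hhm.aestronglyMeasurable M (Eventually.of_forall fun p => ?_)
    have := hhM p
    rw [enorm_le_coe] at this
    exact_mod_cast this
  have hclosed : IsClosed {f : Bw w →L[ℂ] Bw w | IsCompactOperator f} :=
    isClosed_setOfPred_isCompactOperator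
  refine hclosed.closure_subset_iff.2 subset_rfl (EMetric.mem_closure_iff.2 fun ε hε => ?_)
  obtain ⟨δ, hδ0, hδ⟩ : ∃ δ : ℝ≥0∞, δ ≠ 0 ∧ M * c * δ < ε := by
    have : Tendsto (fun δ : ℝ≥0∞ => M * c * δ) (𝓝[≠] 0) (𝓝 (M * c * 0)) :=
      (ENNReal.Tendsto.const_mul tendsto_id
        (Or.inr (by finiteness))).mono_left nhdsWithin_le_nhds
    rw [mul_zero] at this
    obtain ⟨δ, h1, h2⟩ := ((this.eventually_lt_const hε).and self_mem_nhdsWithin).exists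
    exact ⟨δ, h2, h1⟩
  obtain ⟨h₀, hh₀, hε₀⟩ := exists_separated_eLpNorm_sub_le hL1 hδ0
  obtain ⟨hh₀m, C₀, hC₀⟩ := measurable_and_bounded_of_mem_adjoin hh₀
  obtain ⟨T₀, hT₀c, hT₀⟩ := exists_compact_densityOp_of_separated w ν hh₀
  refine ⟨T * V * T₀, hT₀c.mul_left (T * V), lt_of_le_of_lt ?_ hδ⟩
  obtain ⟨D, hD⟩ : ∃ D : E → ℝ≥0∞, D = fun z => ∫⁻ y, ‖(h - h₀) (z, y)‖ₑ ∂ν := ⟨_, rfl⟩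
  have hDm : Measurable D := by
    rw [hD]
    exact (hhm.sub hh₀m).enorm.lintegral_prod_right'
  have hDμ : ∫⁻ z, D z ∂μ ≤ δ := by
    refine le_trans (le_of_eq ?_) hε₀
    rw [eLpNorm_one_eq_lintegral_enorm, lintegral_prod _ (hhm.sub hh₀m).enorm.aemeasurable, hD]
  have hDμ' : ∫⁻ y, (w y : ℝ≥0∞)⁻¹ * ∫⁻ z, w z * D z ∂κ y ∂ν ≤ δ := by
    rw [hμ, Measure.lintegral_bind (Kernel.measurable _).aemeasurable hDm.aemeasurable] at hDμ
    simpa only [lintegral_weightedKernel κ _ hDm] using hDμ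
  have hdiff : ∀ f z, ‖(T - T₀) f z‖ₑ ≤ ‖f‖ₑ * (w z * D z) := by
    intro f z
    have hb : ∀ {h : E × E → ℂ} {C : ℝ≥0}, Measurable h → (∀ p, ‖h p‖ₑ ≤ C) →
        Integrable (fun y => f y * (((w z : ℝ) : ℂ) * h (z, y) * ((w y : ℝ) : ℂ)⁻¹)) ν := by
      intro h C hm hC
      refine integrable_mul_of_lintegral_lt_top
        (((hm.comp measurable_prodMk_left).const_mul _).mul hwm.inv) (lt_of_le_of_lt
          (lintegral_mono fun y => enorm_conj_weight_mul_le w (hC (z, y)) z y) ?_) f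
      simp only [lintegral_const, measure_univ, mul_one]
      finiteness
    have heq : (T - T₀) f z =
        ∫ y, f y * (((w z : ℝ) : ℂ) * (h - h₀) (z, y) * ((w y : ℝ) : ℂ)⁻¹) ∂ν := by
      change T f z - T₀ f z = _
      rw [hT, hT₀]
      simp only [hgh]
      rw [← integral_sub (hb hhm hhM) (hb hh₀m fun p => ENNReal.coe_le_coe.2 (hC₀ p))]
      congr 1
      ext y
      simp only [Pi.sub_apply]
      ring
    rw [heq]
    refine (enorm_integral_le_lintegral_enorm _).trans ((lintegral_enorm_mul_le f).trans ?_)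
    gcongr
    rw [hD, ← lintegral_const_mul' _ _ ENNReal.coe_ne_top]
    refine lintegral_mono fun y => ?_
    rw [mul_comm (w z : ℝ≥0∞)]
    exact enorm_conj_weight_mul_le w le_rfl z y
  rw [edist_eq_enorm_sub, ← mul_sub]
  refine Bw.opENorm_le fun f x => ?_
  rw [mul_apply_eq_comp, mul_apply_eq_comp, hT]
  have hVb : ∀ y, ‖V ((T - T₀) f) y‖ₑ ≤ c * ‖f‖ₑ * ∫⁻ z, w z * D z ∂κ y := fun y => by
    rw [mul_assoc, ← lintegral_const_mul' _ _ enorm_ne_top]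
    refine (hV _ y).trans ?_
    gcongr with z
    exact hdiff f z
  have hgb : ∀ y, ‖g (x, y)‖ₑ ≤ M * w x * (w y : ℝ≥0∞)⁻¹ := fun y => by
    rw [← div_eq_mul_inv, ENNReal.le_div_iff_mul_le (Or.inl (w.coe_ne_zero y))
      (Or.inl ENNReal.coe_ne_top)]
    exact hM x y
  calc _ ≤ ∫⁻ y, ‖V ((T - T₀) f) y * g (x, y)‖ₑ ∂ν := enorm_integral_le_lintegral_enorm _
    _ ≤ ∫⁻ y, (M * w x * (c * ‖f‖ₑ)) * ((w y : ℝ≥0∞)⁻¹ * ∫⁻ z, w z * D z ∂κ y) ∂ν := by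
        refine lintegral_mono fun y => ?_
        rw [enorm_mul]
        refine (mul_le_mul' (hVb y) (hgb y)).trans (le_of_eq ?_)
        ring
    _ = (M * w x * (c * ‖f‖ₑ)) * ∫⁻ y, (w y : ℝ≥0∞)⁻¹ * ∫⁻ z, w z * D z ∂κ y ∂ν :=
        lintegral_const_mul' _ _ (by finiteness)
    _ ≤ (M * w x * (c * ‖f‖ₑ)) * δ := by gcongr
    _ = _ := by ring

/-- Cutting the density off where `α^{(w)} ≥ m` changes `T` in norm by at most a constant times the
tail supremum, which tends to `0`. The truncated operators fall under the bounded case, and `T * V *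
T` is a norm limit of compact operators. -/
theorem isCompactOperator_of_memHw {ν : Measure E} [IsProbabilityMeasure ν] {α : E → E → ℝ≥0}
    (hα : MemHw w ν α) (ξ : Multiplier E) {T V : Bw w →L[ℂ] Bw w}
    (hT : ∀ f x, T f x = ∫ y, f y * (((α x y : ℝ) : ℂ) * ξ (x, y)) ∂ν)
    {κ : Kernel E E} [IsSFiniteKernel κ] (hκ : ActsOn w κ) {c : ℝ≥0}
    (hV : ∀ f x, ‖V f x‖ₑ ≤ c * ∫⁻ y, ‖f y‖ₑ ∂κ x) :
    IsCompactOperator (T * V * T : Bw w →L[ℂ] Bw w) := by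
  obtain ⟨K, hK⟩ : ∃ K : ℝ≥0, ∀ p, ‖ξ p‖ₑ ≤ K := by
    obtain ⟨C, hC⟩ := ξ.bounded'
    refine ⟨C.toNNReal, fun p => ?_⟩
    rw [enorm_le_coe, ← NNReal.coe_le_coe, coe_nnnorm]
    exact (hC p).trans (Real.le_coe_toNNReal C)
  have hαm : Measurable fun p : E × E => α p.1 p.2 := hα.measurable
  have hαw : Measurable fun p : E × E => (w p.1)⁻¹ * α p.1 p.2 * w p.2 :=
    ((w.measurable'.comp measurable_fst).inv.mul hαm).mul (w.measurable'.comp measurable_snd)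
  let s : ℝ≥0 → Set (E × E) := fun m => {p | m ≤ (w p.1)⁻¹ * α p.1 p.2 * w p.2}
  have hs : ∀ m, MeasurableSet (s m) := fun m => measurableSet_le measurable_const hαw
  let G : E × E → ℂ := fun p => ((α p.1 p.2 : ℝ) : ℂ) * ξ p
  have hG : Measurable G :=
    (Complex.measurable_ofReal.comp hαm.coe_nnreal_real).mul ξ.measurable'
  have hGe : ∀ x y, ‖G (x, y)‖ₑ * w y ≤ K * w x * ((w x)⁻¹ * α x y * w y : ℝ≥0) := fun x y => by
    have h1 : ‖((α x y : ℝ) : ℂ)‖ₑ = α x y := by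
      rw [← ofReal_norm, Complex.norm_real, Real.norm_of_nonneg (α x y).coe_nonneg,
        ENNReal.ofReal_coe_nnreal]
    have h2 : (w x * ((w x)⁻¹ * α x y * w y) : ℝ≥0) = α x y * w y := by
      rw [← mul_assoc, mul_inv_cancel_left₀]
      exact_mod_cast w.coe_ne_zero x
    rw [mul_assoc (K : ℝ≥0∞), ← ENNReal.coe_mul, h2, enorm_mul, h1, ENNReal.coe_mul,
      mul_comm _ ‖ξ (x, y)‖ₑ, mul_assoc]
    gcongr
    exact hK _
  let δ : ℝ≥0 → ℝ≥0∞ := fun m => ⨆ x, ∫⁻ y in {y | m ≤ (w x)⁻¹ * α x y * w y},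
      (((w x)⁻¹ * α x y * w y : ℝ≥0) : ℝ≥0∞) ∂ν
  have hδ : Tendsto δ atTop (𝓝 0) := hα.uniform
  have hlow : ∀ m x y, ‖(s m)ᶜ.indicator G (x, y)‖ₑ * w y ≤ (K * m : ℝ≥0) * w x := by
    intro m x y
    by_cases h : (x, y) ∈ s m
    · simp [h]
    · rw [Set.indicator_of_mem (by exact h)]
      refine (hGe x y).trans ?_
      have h' : (w x)⁻¹ * α x y * w y ≤ m := (not_le.1 h).le
      rw [ENNReal.coe_mul K m, mul_right_comm]
      gcongr
  have hhigh : ∀ m x, ∫⁻ y, ‖(s m).indicator G (x, y)‖ₑ * w y ∂ν ≤ K * δ m * w x := by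
    intro m x
    have hsx : MeasurableSet {y | m ≤ (w x)⁻¹ * α x y * w y} :=
      measurable_prodMk_left (x := x) (hs m)
    calc _ ≤ ∫⁻ y, {y | m ≤ (w x)⁻¹ * α x y * w y}.indicator (fun y => K * w x *
            ((w x)⁻¹ * α x y * w y : ℝ≥0)) y ∂ν := by
          refine lintegral_mono fun y => ?_
          by_cases h : m ≤ (w x)⁻¹ * α x y * w y
          · rw [Set.indicator_of_mem (by exact h), Set.indicator_of_mem (by exact h)]
            exact hGe x y
          · rw [Set.indicator_of_notMem (by exact h)]
            simp
      _ = K * w x * ∫⁻ y in {y | m ≤ (w x)⁻¹ * α x y * w y},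
            (((w x)⁻¹ * α x y * w y : ℝ≥0) : ℝ≥0∞) ∂ν := by
          rw [lintegral_indicator hsx, lintegral_const_mul' _ _ (by finiteness)]
      _ ≤ K * w x * δ m := by
          gcongr
          exact le_iSup (fun x => ∫⁻ y in {y | m ≤ (w x)⁻¹ * α x y * w y},
            (((w x)⁻¹ * α x y * w y : ℝ≥0) : ℝ≥0∞) ∂ν) x
      _ = _ := by ring
  have hGx : ∀ (t : Set (E × E)), MeasurableSet t → ∀ x,
      Measurable fun y => t.indicator G (x, y) :=
    fun t ht x => (hG.indicator ht).comp measurable_prodMk_left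
  have hlowint : ∀ m x (f : Bw w), Integrable (fun y => f y * (s m)ᶜ.indicator G (x, y)) ν :=
    fun m x f => integrable_mul_of_lintegral_lt_top (hGx _ (hs m).compl x)
      ((lintegral_mono fun y => hlow m x y).trans_lt (by
        simp only [lintegral_const, measure_univ, mul_one]; finiteness)) f
  choose Tm hTm using fun m => exists_densityOp (w := w) ν (hG.indicator (hs m).compl)
    (C := K * m) fun x => (lintegral_mono fun y => hlow m x y).trans (by simp)
  have hlim : Tendsto Tm atTop (𝓝 T) := by
    rw [tendsto_iff_edist_tendsto_0]
    have hKδ : Tendsto (fun m => K * δ m) atTop (𝓝 (K * 0)) :=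
      ENNReal.Tendsto.const_mul hδ (Or.inr ENNReal.coe_ne_top)
    rw [mul_zero] at hKδ
    refine tendsto_of_tendsto_of_tendsto_of_le_of_le' tendsto_const_nhds hKδ
      (Eventually.of_forall fun _ => zero_le) ?_
    -- The tail supremum may be infinite for small `m`; the bound by `1` serves only to make it
    -- finite, hence the tail integrable.
    filter_upwards [hδ.eventually_lt_const one_pos] with m hm
    have hm' : δ m ≠ ∞ := (hm.trans ENNReal.one_lt_top).ne
    rw [edist_comm, edist_eq_enorm_sub]
    refine Bw.opENorm_le fun f x => ?_
    have hint : Integrable (fun y => f y * (s m).indicator G (x, y)) ν :=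
      integrable_mul_of_lintegral_lt_top (hGx _ (hs m) x)
        ((hhigh m x).trans_lt (by finiteness)) f
    have heq : (T - Tm m) f x = ∫ y, f y * (s m).indicator G (x, y) ∂ν := by
      change T f x - Tm m f x = _
      rw [sub_eq_iff_eq_add, hT, hTm, ← integral_add hint (hlowint m x f)]
      congr 1
      ext y
      rw [← mul_add, Set.indicator_self_add_compl_apply]
    rw [heq]
    refine (enorm_integral_le_lintegral_enorm _).trans ((lintegral_enorm_mul_le f).trans ?_)
    calc _ ≤ ‖f‖ₑ * (K * δ m * w x) := by gcongr; exact hhigh m x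
      _ = _ := by ring
  have hclosed : IsClosed {f : Bw w →L[ℂ] Bw w | IsCompactOperator f} :=
    isClosed_setOfPred_isCompactOperator
  refine hclosed.mem_of_tendsto ((hlim.mul_const V).mul hlim) (Eventually.of_forall fun m => ?_)
  exact isCompactOperator_density_comp ν (hG.indicator (hs m).compl) (hlow m) (hTm m) hκ hV

end Compactness

/-! ### Conditional averages of multipliers and powers of twisted operators -/

section ConditionalDensity

variable {E : Type*} [MeasurableSpace E]

/-- `d (x, ·)` is the conditional expectation of `φ (x, ·)` given the second coordinate. It is
obtained as a Radon–Nikodym derivative between kernels, so as to be measurable jointly in `x` and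
`z`. -/
theorem exists_density_snd_nnreal [MeasurableSpace.CountableOrCountablyGenerated E E]
    (Λ : Kernel E (E × E)) [IsFiniteKernel Λ] {φ : E × (E × E) → ℝ≥0} (hφ : Measurable φ) {C : ℝ≥0}
    (hC : ∀ p, φ p ≤ C) :
    ∃ d : E × E → ℝ≥0, Measurable d ∧ (∀ p, d p ≤ C) ∧ ∀ x, ∀ f : E → ℂ, Measurable f →
      ∫ p, φ (x, p) • f p.2 ∂Λ x = ∫ z, d (x, z) • f z ∂(Λ.snd) x := by
  set N : Kernel E (E × E) := Λ.withDensity fun x p => (φ (x, p) : ℝ≥0∞) with hN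
  have hφm : Measurable (Function.uncurry fun x p => (φ (x, p) : ℝ≥0∞)) := hφ.coe_nnreal_ennreal
  have hNfin : IsFiniteKernel N :=
    Kernel.isFiniteKernel_withDensity_of_bounded Λ (B := C) ENNReal.coe_ne_top
      fun x p => ENNReal.coe_le_coe.2 (hC (x, p))
  have hNx : ∀ x, N x = (Λ x).withDensity fun p => (φ (x, p) : ℝ≥0∞) := fun x =>
    Kernel.withDensity_apply _ hφm x
  have hle : ∀ x s, MeasurableSet s → N.snd x s ≤ C * Λ.snd x s := fun x s hs => by
    rw [Kernel.snd_apply' _ _ hs, Kernel.snd_apply' _ _ hs, hNx,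
      withDensity_apply _ (measurable_snd hs)]
    exact (setLIntegral_mono measurable_const fun p _ => ENNReal.coe_le_coe.2 (hC (x, p))).trans
      (by simp)
  have hac : ∀ x, N.snd x ≪ Λ.snd x := fun x => Measure.AbsolutelyContinuous.mk fun s hs h0 =>
    le_antisymm ((hle x s hs).trans (by rw [h0, mul_zero])) zero_le
  have hD : ∀ x, N.snd x = (Λ.snd x).withDensity (N.snd.rnDeriv Λ.snd x) := fun x => by
    rw [← Kernel.withDensity_apply _ (Kernel.measurable_rnDeriv _ _),
      Kernel.withDensity_rnDeriv_eq (hac x)]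
  have hae : ∀ x, N.snd.rnDeriv Λ.snd x ≤ᵐ[Λ.snd x] fun _ => (C : ℝ≥0∞) := fun x => by
    refine ae_le_of_forall_setLIntegral_le_of_sigmaFinite
      (Kernel.measurable_rnDeriv_right _ _ x) fun s hs _ => ?_
    rw [← withDensity_apply _ hs, ← hD, setLIntegral_const]
    exact hle x s hs
  -- The derivative is at most `C` only almost everywhere; the minimum makes the bound hold at every
  -- point.
  refine ⟨fun p => (min (N.snd.rnDeriv Λ.snd p.1 p.2) C).toNNReal,
    ((Kernel.measurable_rnDeriv _ _).min measurable_const).ennreal_toNNReal, fun p => ?_,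
    fun x f hf => ?_⟩
  · exact (ENNReal.toNNReal_mono ENNReal.coe_ne_top (min_le_right _ _)).trans_eq
      (ENNReal.toNNReal_coe C)
  have hdm : Measurable fun z => (min (N.snd.rnDeriv Λ.snd x z) C).toNNReal :=
    ((Kernel.measurable_rnDeriv_right _ _ x).min measurable_const).ennreal_toNNReal
  have h1 : N.snd x =
      (Λ.snd x).withDensity fun z => ((min (N.snd.rnDeriv Λ.snd x z) C).toNNReal : ℝ≥0∞) := by
    rw [hD]
    refine withDensity_congr_ae ?_
    filter_upwards [hae x] with z hz
    rw [min_eq_left hz, ENNReal.coe_toNNReal (ne_top_of_le_ne_top ENNReal.coe_ne_top hz)]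
  have hφx : Measurable fun p => φ (x, p) := hφ.comp measurable_prodMk_left
  rw [← integral_withDensity_eq_integral_smul hdm, ← h1,
    ← integral_withDensity_eq_integral_smul hφx, Kernel.snd_apply,
    integral_map measurable_snd.aemeasurable hf.aestronglyMeasurable, hNx]

/-- Testing against the conjugate phase of `ψ` on a set `s` bounds the integral of `‖ψ‖` over `s` by
`K` times the measure of `s`. -/
theorem ae_enorm_le_of_forall_integral_le {m : Measure E} [IsFiniteMeasure m] {ψ : E → ℂ}
    (hψ : Measurable ψ) (hint : Integrable ψ m) {K : ℝ≥0∞}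
    (h : ∀ f : E → ℂ, Measurable f → (∀ x, ‖f x‖ ≤ 1) →
      ‖∫ x, f x * ψ x ∂m‖ₑ ≤ K * ∫⁻ x, ‖f x‖ₑ ∂m) : ∀ᵐ x ∂m, ‖ψ x‖ₑ ≤ K := by
  refine ae_le_of_forall_setLIntegral_le_of_sigmaFinite hψ.enorm fun s hs _ => ?_
  let u : E → ℂ := fun x => (starRingEnd ℂ) (ψ x) * ((‖ψ x‖ : ℝ) : ℂ)⁻¹
  have hu : Measurable u := (Complex.continuous_conj.measurable.comp hψ).mul
    (Complex.measurable_ofReal.comp hψ.norm).inv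
  have hu1 : ∀ x, ‖u x‖ ≤ 1 := fun x => by
    simp only [u, norm_mul, RCLike.norm_conj, norm_inv, Complex.norm_real, norm_norm]
    exact mul_inv_le_one
  have huψ : ∀ x, u x * ψ x = ((‖ψ x‖ : ℝ) : ℂ) := fun x => by
    simp only [u]
    rw [mul_right_comm, mul_comm ((starRingEnd ℂ) (ψ x)), Complex.mul_conj, Complex.normSq_eq_norm_sq]
    rcases eq_or_ne (ψ x) 0 with h0 | h0
    · simp [h0]
    · have : ((‖ψ x‖ : ℝ) : ℂ) ≠ 0 := by simpa using h0
      push_cast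
      field_simp
  have h1 := h (s.indicator u) (hu.indicator hs) fun x =>
    (norm_indicator_le_norm_self _ _).trans (hu1 x)
  have h2 : ∀ x, s.indicator u x * ψ x = s.indicator (fun x => ((‖ψ x‖ : ℝ) : ℂ)) x := fun x => by
    by_cases hx : x ∈ s <;> simp [hx, huψ]
  have h3 : ‖∫ x, s.indicator u x * ψ x ∂m‖ₑ = ∫⁻ x in s, ‖ψ x‖ₑ ∂m := by
    simp only [h2]
    rw [integral_indicator hs, integral_complex_ofReal, ← ofReal_norm, Complex.norm_real,
      Real.norm_of_nonneg (integral_nonneg fun _ => norm_nonneg _),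
      ofReal_integral_norm_eq_lintegral_enorm hint.integrableOn]
  rw [h3] at h1
  refine h1.trans ?_
  rw [lintegral_const, Measure.restrict_apply_univ]
  gcongr
  calc ∫⁻ x, ‖s.indicator u x‖ₑ ∂m ≤ ∫⁻ x, s.indicator (fun _ => 1) x ∂m := by
        refine lintegral_mono fun x => ?_
        rw [enorm_indicator_eq_indicator_enorm]
        refine Set.indicator_le_indicator ?_
        rw [← ofReal_norm, ← ENNReal.ofReal_one]
        exact ENNReal.ofReal_le_ofReal (hu1 x)
    _ = m s := by rw [lintegral_indicator_const hs, one_mul]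

theorem integral_mul_shift {X : Type*} [MeasurableSpace X] {m : Measure X} {f : X → ℂ}
    (hf : Integrable f m) {a b : X → ℝ≥0} (ha : Measurable a) (hb : Measurable b) {C : ℝ≥0}
    (haC : ∀ x, a x ≤ C) (hbC : ∀ x, b x ≤ C) (k : ℂ) :
    ∫ x, f x * (((a x : ℝ) : ℂ) - k + Complex.I * (((b x : ℝ) : ℂ) - k)) ∂m =
      ∫ x, a x • f x ∂m - k * ∫ x, f x ∂m + Complex.I * (∫ x, b x • f x ∂m - k * ∫ x, f x ∂m) := by
  have key : ∀ a : X → ℝ≥0, Measurable a → (∀ x, a x ≤ C) → Integrable (fun x => a x • f x) m := by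
    intro a ha haC
    have : Integrable (fun x => ((a x : ℝ) : ℂ) * f x) m := by
      refine hf.bdd_mul (c := C)
        (Complex.measurable_ofReal.comp ha.coe_nnreal_real).aestronglyMeasurable
        (Eventually.of_forall fun x => ?_)
      rw [Complex.norm_real, Real.norm_of_nonneg (a x).coe_nonneg]
      exact_mod_cast haC x
    exact this
  have hka := (key a ha haC).sub (hf.const_mul k)
  have hkb := ((key b hb hbC).sub (hf.const_mul k)).const_mul Complex.I
  have heq : ∀ x, f x * (((a x : ℝ) : ℂ) - k + Complex.I * (((b x : ℝ) : ℂ) - k)) =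
      (a x • f x - k * f x) + Complex.I * (b x • f x - k * f x) := fun x => by
    change _ = (((a x : ℝ) : ℂ) * f x - k * f x) + Complex.I * (((b x : ℝ) : ℂ) * f x - k * f x)
    ring
  simp only [heq]
  rw [← integral_const_mul, ← integral_sub (key a ha haC) (hf.const_mul k),
    ← integral_sub (key b hb hbC) (hf.const_mul k), ← integral_const_mul]
  exact integral_add hka hkb

/-- Real and imaginary parts are shifted by `K` to become nonnegative and are conditioned
separately. That only gives a crude bound, so the sharp bound `K` is recovered almost everywhere by
duality. Sharpness matters: any lost factor would enter the final spectral estimate. -/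
theorem exists_density_snd [MeasurableSpace.CountableOrCountablyGenerated E E]
    (Λ : Kernel E (E × E)) [IsFiniteKernel Λ] {θ : E × (E × E) → ℂ} (hθ : Measurable θ) {K : ℝ≥0}
    (hK : ∀ p, ‖θ p‖ₑ ≤ K) :
    ∃ ξ : Multiplier E, (∀ p, ‖ξ p‖ₑ ≤ K) ∧ ∀ x, ∀ f : E → ℂ, Measurable f →
      Integrable f (Λ.snd x) → ∫ p, f p.2 * θ (x, p) ∂Λ x = ∫ z, f z * ξ (x, z) ∂(Λ.snd) x := by
  have hK' : ∀ p, ‖θ p‖ ≤ K := fun p => by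
    have := hK p
    rw [enorm_le_coe] at this
    exact_mod_cast this
  let a : E × (E × E) → ℝ≥0 := fun p => (K + (θ p).re).toNNReal
  let b : E × (E × E) → ℝ≥0 := fun p => (K + (θ p).im).toNNReal
  have ha : Measurable a := (measurable_const.add (Complex.measurable_re.comp hθ)).real_toNNReal
  have hb : Measurable b := (measurable_const.add (Complex.measurable_im.comp hθ)).real_toNNReal
  have haC : ∀ p, a p ≤ 2 * K := fun p => Real.toNNReal_le_iff_le_coe.2 (by
    have := (Complex.re_le_norm (θ p)).trans (hK' p)
    push_cast
    linarith)
  have hbC : ∀ p, b p ≤ 2 * K := fun p => Real.toNNReal_le_iff_le_coe.2 (by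
    have := (Complex.im_le_norm (θ p)).trans (hK' p)
    push_cast
    linarith)
  have hθab : ∀ p, θ p = ((a p : ℝ) : ℂ) - (K : ℝ) + Complex.I * (((b p : ℝ) : ℂ) - (K : ℝ)) := by
    intro p
    have h1 := (abs_le.1 ((Complex.abs_re_le_norm (θ p)).trans (hK' p))).1
    have h2 := (abs_le.1 ((Complex.abs_im_le_norm (θ p)).trans (hK' p))).1
    simp only [a, b]
    rw [Real.coe_toNNReal _ (by linarith), Real.coe_toNNReal _ (by linarith)]
    apply Complex.ext <;> simp
  obtain ⟨da, hda, hdaC, hda'⟩ := exists_density_snd_nnreal Λ ha haC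
  obtain ⟨db, hdb, hdbC, hdb'⟩ := exists_density_snd_nnreal Λ hb hbC
  obtain ⟨ψ, hψ⟩ : ∃ ψ : E × E → ℂ, ψ = fun p =>
      ((da p : ℝ) : ℂ) - (K : ℝ) + Complex.I * (((db p : ℝ) : ℂ) - (K : ℝ)) := ⟨_, rfl⟩
  have hψm : Measurable ψ := by
    rw [hψ]
    exact ((Complex.measurable_ofReal.comp hda.coe_nnreal_real).sub measurable_const).add
      (((Complex.measurable_ofReal.comp hdb.coe_nnreal_real).sub measurable_const).const_mul _)
  -- Each shifted part is at most `2 * K + K`. This bound is used only for integrability and as the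
  -- bound stored in the multiplier.
  have hψb : ∀ p, ‖ψ p‖ ≤ 6 * K := fun p => by
    have h1 : (da p : ℝ) ≤ 2 * K := by exact_mod_cast hdaC p
    have h2 : (db p : ℝ) ≤ 2 * K := by exact_mod_cast hdbC p
    have e : ∀ t : ℝ≥0, ‖((t : ℝ) : ℂ)‖ = t := fun t => by
      rw [Complex.norm_real, Real.norm_of_nonneg t.coe_nonneg]
    rw [hψ]
    calc _ ≤ (‖((da p : ℝ) : ℂ)‖ + ‖((K : ℝ) : ℂ)‖) +
          ‖Complex.I‖ * (‖((db p : ℝ) : ℂ)‖ + ‖((K : ℝ) : ℂ)‖) := by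
          refine (norm_add_le _ _).trans (add_le_add (norm_sub_le _ _) ?_)
          rw [norm_mul]
          gcongr
          exact norm_sub_le _ _
      _ ≤ _ := by rw [e, e, e, Complex.norm_I]; linarith
  have hψint : ∀ x, ∀ f : E → ℂ, Measurable f → Integrable f (Λ.snd x) →
      ∫ p, f p.2 * θ (x, p) ∂Λ x = ∫ z, f z * ψ (x, z) ∂(Λ.snd) x := by
    intro x f hf hfi
    have hfi' : Integrable (fun p : E × E => f p.2) (Λ x) := by
      rw [Kernel.snd_apply] at hfi
      exact hfi.comp_measurable measurable_snd
    have hfs : ∫ p, f p.2 ∂Λ x = ∫ z, f z ∂(Λ.snd) x := by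
      rw [Kernel.snd_apply, integral_map measurable_snd.aemeasurable hf.aestronglyMeasurable]
    simp only [hθab, hψ]
    rw [integral_mul_shift (a := fun p => a (x, p)) (b := fun p => b (x, p)) hfi'
      (ha.comp measurable_prodMk_left) (hb.comp measurable_prodMk_left)
      (fun p => haC (x, p)) (fun p => hbC (x, p)),
      integral_mul_shift (a := fun z => da (x, z)) (b := fun z => db (x, z)) hfi
      (hda.comp measurable_prodMk_left) (hdb.comp measurable_prodMk_left)
      (fun p => hdaC (x, p)) (fun p => hdbC (x, p)), hda' x f hf, hdb' x f hf, hfs]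
  have hae : ∀ x, ∀ᵐ z ∂(Λ.snd) x, ‖ψ (x, z)‖ₑ ≤ K := fun x => by
    refine ae_enorm_le_of_forall_integral_le (ψ := fun z => ψ (x, z)) (hψm.comp measurable_prodMk_left)
      (Integrable.of_bound (hψm.comp measurable_prodMk_left).aestronglyMeasurable (6 * K)
        (Eventually.of_forall fun z => hψb (x, z))) fun f hf hf1 => ?_
    rw [← hψint x f hf (Integrable.of_bound hf.aestronglyMeasurable 1 (Eventually.of_forall hf1)),
      Kernel.lintegral_snd _ _ hf.enorm, ← lintegral_const_mul' _ _ ENNReal.coe_ne_top]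
    refine (enorm_integral_le_lintegral_enorm _).trans (lintegral_mono fun p => ?_)
    rw [enorm_mul, mul_comm]
    gcongr
    exact hK _
  have hset : MeasurableSet {p | ‖ψ p‖ₑ ≤ K} := measurableSet_le hψm.enorm measurable_const
  have hbd : ∀ p, ‖{p | ‖ψ p‖ₑ ≤ K}.indicator ψ p‖ₑ ≤ K := fun p => by
    by_cases h : ‖ψ p‖ₑ ≤ K
    · rwa [Set.indicator_of_mem (by exact h)]
    · rw [Set.indicator_of_notMem (by exact h)]
      simp
  -- Setting `ψ` to zero on the exceptional null sets makes the sharp bound hold everywhere without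
  -- changing the integrals.
  refine ⟨⟨{p | ‖ψ p‖ₑ ≤ K}.indicator ψ, hψm.indicator hset, 6 * K,
    fun p => (norm_indicator_le_norm_self _ _).trans (hψb p)⟩, hbd, fun x f hf hfi => ?_⟩
  rw [hψint x f hf hfi]
  refine integral_congr_ae ?_
  filter_upwards [hae x] with z hz
  rw [Set.indicator_of_mem (by exact hz)]

/-- The product integrates `χ (x, y) * ξ (y, z)` over two-step paths `x → y → z`; `ζ (x, z)` is its
average over `y` given the endpoint. -/
theorem exists_twistedOp_mul [MeasurableSpace.CountableOrCountablyGenerated E E] {w : Weight E}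
    {κ η τ : Kernel E E} [IsFiniteKernel κ] [IsFiniteKernel η] [IsFiniteKernel τ]
    (hτe : τ = η ∘ₖ κ) (hκ : ActsOn w κ) (hη : ActsOn w η) (hτ : ActsOn w τ) {χ ξ : Multiplier E}
    {c d : ℝ≥0} (hc : ∀ p, ‖χ p‖ₑ ≤ c) (hd : ∀ p, ‖ξ p‖ₑ ≤ d) :
    ∃ ζ : Multiplier E, (∀ p, ‖ζ p‖ₑ ≤ (c * d : ℝ≥0)) ∧
      twistedOp hκ χ * twistedOp hη ξ = twistedOp hτ ζ := by
  have hθm : Measurable fun p : E × (E × E) => χ (p.1, p.2.1) * ξ p.2 :=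
    (χ.measurable'.comp (measurable_fst.prodMk measurable_snd.fst)).mul
      (ξ.measurable'.comp measurable_snd)
  have hθ : ∀ p : E × (E × E), ‖χ (p.1, p.2.1) * ξ p.2‖ₑ ≤ (c * d : ℝ≥0) := fun p => by
    rw [enorm_mul, ENNReal.coe_mul]
    exact mul_le_mul' (hc _) (hd _)
  obtain ⟨ζ, hζ, hζi⟩ := exists_density_snd (κ ⊗ₖ Kernel.prodMkLeft E η) hθm hθ
  rw [Kernel.snd_compProd_prodMkLeft, ← hτe] at hζi
  refine ⟨ζ, hζ, ?_⟩
  ext1 f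
  refine Bw.ext fun x => ?_
  have hfi := hτ.integrable f x
  have hfi' : Integrable (fun p : E × E => f p.2) ((κ ⊗ₖ Kernel.prodMkLeft E η) x) := by
    rw [hτe, ← Kernel.snd_compProd_prodMkLeft, Kernel.snd_apply] at hfi
    exact hfi.comp_measurable measurable_snd
  have hint : Integrable (fun p : E × E => f p.2 * (χ (x, p.1) * ξ p))
      ((κ ⊗ₖ Kernel.prodMkLeft E η) x) := by
    refine hfi'.mul_bdd (c := (c * d : ℝ≥0))
      (hθm.comp (measurable_prodMk_left (x := x))).aestronglyMeasurable
      (Eventually.of_forall fun p => ?_)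
    have := hθ (x, p)
    rw [enorm_le_coe] at this
    exact_mod_cast this
  rw [twistedOp_apply, ← hζi x f f.measurable hfi, integral_compProd hint, mul_apply_eq_comp,
    twistedOp_apply]
  congr 1
  ext y
  rw [twistedOp_apply, ← integral_mul_const, Kernel.prodMkLeft_apply]
  congr 1
  ext z
  ring

theorem twistedOp_pow_one {w : Weight E} {κ : Kernel E E} [IsFiniteKernel κ] (hκ : ActsOn w κ)
    (χ : Multiplier E) : (twistedOp hκ χ) ^ 1 = twistedOp (hκ.pow 1) χ := by
  ext1 f
  refine Bw.ext fun x => ?_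
  rw [pow_one, twistedOp_apply, twistedOp_apply, pow_one]

theorem exists_twistedOp_pow [MeasurableSpace.CountableOrCountablyGenerated E E] {w : Weight E}
    {κ : Kernel E E} [IsFiniteKernel κ] (hκ : ActsOn w κ) {χ : Multiplier E} {c : ℝ≥0}
    (hc : ∀ p, ‖χ p‖ₑ ≤ c) {n : ℕ} (hn : 1 ≤ n) : ∃ ξ : Multiplier E,
      (∀ p, ‖ξ p‖ₑ ≤ (c ^ n : ℝ≥0)) ∧ (twistedOp hκ χ) ^ n = twistedOp (hκ.pow n) ξ := by
  induction n, hn using Nat.le_induction with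
  | base =>
    exact ⟨χ, by simpa using hc, twistedOp_pow_one hκ χ⟩
  | succ n hn ih =>
    obtain ⟨ξ, hξ, h⟩ := ih
    obtain ⟨ζ, hζ, h'⟩ := exists_twistedOp_mul (pow_succ κ n) hκ (hκ.pow n) (hκ.pow (n + 1)) hc hξ
    exact ⟨ζ, by simpa only [pow_succ'] using hζ, by rw [pow_succ', h, h']⟩

end ConditionalDensity

/-! ### The bound on the essential spectral radius -/

section Main

variable {E : Type*} [MeasurableSpace E] {w : Weight E}

theorem IsNonnegDiff.isFiniteKernel {S κ T : Kernel E E} [IsFiniteKernel κ]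
    (h : IsNonnegDiff S κ T) : IsFiniteKernel S :=
  ⟨⟨κ.bound, κ.bound_lt_top, fun x => ((h.eq x _ MeasurableSet.univ).le.trans tsub_le_self).trans
    (κ.measure_le_bound x _)⟩⟩

theorem IsNonnegDiff.apply_eq_add {S κ T : Kernel E E} [IsFiniteKernel κ]
    (h : IsNonnegDiff S κ T) (x : E) : κ x = S x + T x := by
  ext A hA
  rw [Measure.add_apply, h.eq x A hA, tsub_add_cancel_of_le (h.le x A hA)]

/-- Twisting `κ = S + T` by `ξ` writes `U ^ l` as a part of spectral radius at most `c ^ l r(S)`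
plus a part with density `α ξ`. The perturbation principle then applies to `U ^ l`, and taking
`l`-th roots gives the bound for `U`. -/
theorem essSpectralRadius_le_of_pow_eq_twistedOp {κ : Kernel E E} [IsFiniteKernel κ]
    (hκ : ActsOn w κ) {ν : Measure E} [IsProbabilityMeasure ν] {α : E → E → ℝ≥0}
    (hα : MemHw w ν α) {S : Kernel E E} (hS : IsNonnegDiff S κ (absContKernel ν α))
    {l : ℕ} (hl : 1 ≤ l) {ξ : Multiplier E} {c : ℝ≥0} (hξ : ∀ p, ‖ξ p‖ₑ ≤ (c ^ l : ℝ≥0))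
    {U : Bw w →L[ℂ] Bw w} (hU : U ^ l = twistedOp hκ ξ) :
    essSpectralRadius U ≤
      c * spectralRadius ℂ (kernelOp (hκ.of_isNonnegDiff hS)) ^ (1 / (l : ℝ)) := by
  have := hS.isFiniteKernel
  have hSw := hκ.of_isNonnegDiff hS
  set Sξ := twistedOp hSw ξ with hSξ
  obtain ⟨T, hT⟩ : ∃ T, T = U ^ l - Sξ := ⟨_, rfl⟩
  have hsum : U ^ l = Sξ + T := by rw [hT]; abel
  have hTf : ∀ f x, T f x = ∫ y, f y * (((α x y : ℝ) : ℂ) * ξ (x, y)) ∂ν := by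
    intro f x
    have hint := hκ.integrable_mul ξ f x
    rw [hS.apply_eq_add x] at hint
    have h2 : T f x = (∫ y, f y * ξ (x, y) ∂κ x) - ∫ y, f y * ξ (x, y) ∂S x := by
      rw [hT, hU]; rfl
    rw [h2, hS.apply_eq_add x, integral_add_measure hint.left_of_add_measure
      hint.right_of_add_measure, add_sub_cancel_left, absContKernel,
      Kernel.integral_withDensity hα.measurable, Kernel.const_apply]
    congr 1
    ext y
    rw [NNReal.smul_def, Complex.real_smul]
    ring
  have hcomp : ∀ k : ℕ, IsCompactOperator (T * Sξ ^ k * T : Bw w →L[ℂ] Bw w) := fun k =>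
    isCompactOperator_of_memHw hα ξ hTf (hSw.pow k) (c := (c ^ l) ^ k) fun f x => by
      rw [ENNReal.coe_pow]
      exact enorm_twistedOp_pow_le hSw hξ k f x
  have hl0 : (0 : ℝ) < l := by exact_mod_cast hl
  have hrad : spectralRadius ℂ Sξ ≤ (c ^ l : ℝ≥0) * spectralRadius ℂ (kernelOp hSw) :=
    spectralRadius_twistedOp_le hSw ENNReal.coe_ne_top hξ
  by_contra! hlt
  obtain ⟨ρ, hρ1, hρ2⟩ := ENNReal.lt_iff_exists_nnreal_btwn.1 hlt
  refine hρ2.not_ge (PowNearCompact.essSpectralRadius_le (PowNearCompact.of_pow hl ?_))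
  rw [hsum]
  refine powNearCompact_add hcomp (hrad.trans_lt ?_)
  have h3 := ENNReal.rpow_lt_rpow hρ1 hl0
  rwa [ENNReal.mul_rpow_of_nonneg _ _ hl0.le, ← ENNReal.rpow_mul, one_div_mul_cancel hl0.ne',
    ENNReal.rpow_one, ENNReal.rpow_natCast, ENNReal.rpow_natCast, ← ENNReal.coe_pow,
    ← ENNReal.coe_pow] at h3

/-- The multiplier `1`. -/
noncomputable def Multiplier.one (E : Type*) [MeasurableSpace E] : Multiplier E :=
  ⟨fun _ => 1, measurable_const, 1, fun _ => by simp⟩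

theorem twistedOp_one {κ : Kernel E E} [IsFiniteKernel κ] (hκ : ActsOn w κ) :
    twistedOp hκ (Multiplier.one E) = kernelOp hκ := by
  ext1 f
  refine Bw.ext fun x => ?_
  rw [twistedOp_apply, kernelOp_apply]
  simp [Multiplier.one]

theorem Multiplier.exists_coe_eq_supNorm (χ : Multiplier E) :
    ∃ c : ℝ≥0, χ.supNorm = c ∧ ∀ p, ‖χ p‖ₑ ≤ c := by
  obtain ⟨C, hC⟩ := χ.bounded'
  have h : χ.supNorm ≠ ∞ := ne_top_of_le_ne_top (ENNReal.ofReal_ne_top (r := C)) <|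
    iSup_le fun p => by
      rw [← ofReal_norm]
      exact ENNReal.ofReal_le_ofReal (hC p)
  refine ⟨χ.supNorm.toNNReal, (ENNReal.coe_toNNReal h).symm, fun p => ?_⟩
  rw [ENNReal.coe_toNNReal h]
  exact le_iSup (fun p => ‖χ p‖ₑ) p

end Main

end WeightedKernel

theorem mainTheorem11 {E : Type*} [MeasurableSpace E] (w : Weight E)
    (Q : Kernel E E) [IsFiniteKernel Q] (hQ : ActsOn w Q)
    (l : ℕ) (hl : 1 ≤ l)
    (ν : Measure E) [IsProbabilityMeasure ν]
    (α : E → E → ℝ≥0) (hα : MemHw w ν α)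
    (S : Kernel E E) (hS : IsNonnegDiff S (Q ^ l) (absContKernel ν α))
    (hr : spectralRadius ℂ (kernelOp ((hQ.pow l).of_isNonnegDiff hS)) ^ (1 / (l : ℝ)) <
      spectralRadius ℂ (kernelOp hQ)) :
    (QuasiCompact (kernelOp hQ) ∧
      essSpectralRadius (kernelOp hQ) ≤
        spectralRadius ℂ (kernelOp ((hQ.pow l).of_isNonnegDiff hS)) ^ (1 / (l : ℝ))) ∧
    ((l = 1 ∨ MeasurableSpace.CountablyGenerated E) →
      ∀ χ : Multiplier E,
        χ.supNorm * spectralRadius ℂ (kernelOp ((hQ.pow l).of_isNonnegDiff hS)) ^ (1 / (l : ℝ)) <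
          spectralRadius ℂ (twistedOp hQ χ) →
        QuasiCompact (twistedOp hQ χ) ∧
        essSpectralRadius (twistedOp hQ χ) ≤
          χ.supNorm *
            spectralRadius ℂ (kernelOp ((hQ.pow l).of_isNonnegDiff hS)) ^ (1 / (l : ℝ))) := by
  have hone : essSpectralRadius (kernelOp hQ) ≤
      spectralRadius ℂ (kernelOp ((hQ.pow l).of_isNonnegDiff hS)) ^ (1 / (l : ℝ)) := by
    -- For `Q` itself the multiplier of the `l`-th power is `1`, so no conditioning, and no
    -- countability assumption, is needed.
    have := essSpectralRadius_le_of_pow_eq_twistedOp (hQ.pow l) hα hS hl (ξ := Multiplier.one E)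
      (c := 1) (U := kernelOp hQ) (fun p => by simp [Multiplier.one])
      (by rw [twistedOp_one, kernelOp_pow])
    rwa [ENNReal.coe_one, one_mul] at this
  refine ⟨⟨hone.trans_lt hr, hone⟩, fun hcg χ hχ => ?_⟩
  obtain ⟨c, hcχ, hc⟩ := χ.exists_coe_eq_supNorm
  obtain ⟨ξ, hξ, hpow⟩ : ∃ ξ : Multiplier E, (∀ p, ‖ξ p‖ₑ ≤ (c ^ l : ℝ≥0)) ∧
      (twistedOp hQ χ) ^ l = twistedOp (hQ.pow l) ξ := by
    -- When `l = 1` the multiplier is `χ` itself; otherwise it is a conditional average, and this is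
    -- where countable generation enters.
    rcases hcg with rfl | hcg
    · exact ⟨χ, by simpa using hc, twistedOp_pow_one hQ χ⟩
    · exact exists_twistedOp_pow hQ hc hl
  have hle := essSpectralRadius_le_of_pow_eq_twistedOp (hQ.pow l) hα hS hl hξ hpow
  rw [← hcχ] at hle
  exact ⟨hle.trans_lt hχ, hle⟩
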